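/- A $C^\infty$-ring is a product preserving functor from the category of the spaces $\mathbb R^n$ ($n\ge 0$) and smooth maps to sets; it is finitely generated if it is a quotient of some $C^\infty(\mathbb R^n)$, and local if it has a unique maximal ideal $\mathfrak m$ and $A/\mathfrak m\cong\mathbb R$. A $C^\infty$-space is a Hausdorff space with a soft sheaf of finitely generated $C^\infty$-rings all of whose stalks are local. For a simplicial $C^\infty$-ring $A_\bullet$, let $\pi_k(A_\bullet)$ be the $k$-th homotopy group of the underlying simplicial set at the base point $0$; $\pi_0(A_\bullet)$ is a $C^\infty$-ring and $\pi_k(A_\bullet)$, $k\ge 1$, is a $\pi_0(A_\bullet)$-module. For a sheaf $\mathcal O_\bullet$ of simplicial $C^\infty$-rings on a space $X$, let $\pi_k(\mathcal O_\bullet)$ be the sheaf associated to $U\mapsto\pi_k(\Gamma(U,\mathcal O_\bullet))$. A simplicial $C^\infty$-space is a pair $(X,\mathcal O_\bullet)$ for which $(X,\pi_0(\mathcal O_\bullet))$ is a $C^\infty$-space; it is localized if in addition all stalks of $\mathcal O_0$ are local $C^\infty$-rings. A morphism $(X,\mathcal O_{\bullet,X})\to(Y,\mathcal O_{\bullet,Y})$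 is a continuous map $\phi:X\to Y$ with a morphism $\mathcal O_{\bullet,Y}\to\phi_*\mathcal O_{\bullet,X}$ of sheaves of simplicial $C^\infty$-rings. It is a local weak equivalence if $\phi$ is a homeomorphism and the induced maps $\pi_k(\mathcal O_{\bullet,Y})\to\phi_*\pi_k(\mathcal O_{\bullet,X})$ are isomorphisms for all $k\ge 0$. A morphism of simplicial $C^\infty$-rings is a weak equivalence if the underlying map of simplicial sets is one. **Proposition.** Let $(X,\mathcal O_\bullet)$ be a localized simplicial $C^\infty$-space. For every $k\ge 0$ the canonical map $$\pi_k(\Gamma(X,\mathcal O_\bullet))\longrightarrow\Gamma(X,\pi_k(\mathcal O_\bullet))$$ is an isomorphism: of $C^\infty$-rings for $k=0$, and, for $k\ge 1$, of abelian groups, linear over the isomorphism for $k=0$. In particular $\pi_0(\Gamma(X,\mathcal O_\bullet))$ is a finitely generated $C^\infty$-ring. Moreover, the functor of global sections $\Gamma$ from localized simplicial $C^\infty$-spaces to (the opposite category of) simplicial $C^\infty$-rings maps local weak equivalences to weak equivalences. -/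

import Mathlib

open CategoryTheory Opposite TopologicalSpace Simplicial
open scoped ContDiff

universe u v w

namespace DerivedCInf

/-- Smooth functions `ℝⁿ → ℝ`. -/
structure SmoothFn (n : ℕ) : Type where
  toFun : (Fin n → ℝ) → ℝ
  smooth : ContDiff ℝ ∞ toFun

namespace SmoothFn

theorem ext' {n : ℕ} {f g : SmoothFn n} (h : ∀ x, f.toFun x = g.toFun x) : f = g := by
  cases f; cases g; congr; exact funext h

/-- The `i`-th coordinate function. -/
def proj {n : ℕ} (i : Fin n) : SmoothFn n := ⟨fun x => x i, contDiff_apply ℝ ℝ i⟩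

/-- Substitution of smooth functions into a smooth function. -/
def comp {m n : ℕ} (f : SmoothFn n) (g : Fin n → SmoothFn m) : SmoothFn m :=
  ⟨fun x => f.toFun (fun i => (g i).toFun x),
    f.smooth.comp (contDiff_pi.2 fun i => (g i).smooth)⟩

def const (n : ℕ) (r : ℝ) : SmoothFn n := ⟨fun _ => r, contDiff_const⟩

def add {n : ℕ} (f g : SmoothFn n) : SmoothFn n :=
  ⟨fun x => f.toFun x + g.toFun x, f.smooth.add g.smooth⟩

def mul {n : ℕ} (f g : SmoothFn n) : SmoothFn n :=
  ⟨fun x => f.toFun x * g.toFun x, f.smooth.mul g.smooth⟩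

def neg {n : ℕ} (f : SmoothFn n) : SmoothFn n := ⟨fun x => - f.toFun x, f.smooth.neg⟩

end SmoothFn

/-- A `C^∞`-ring: a set with compatible operations by all smooth functions `ℝⁿ → ℝ`, i.e. an
algebra over the algebraic theory of Euclidean spaces and smooth maps. -/
class CInfRing (A : Type u) where
  op : ∀ {n : ℕ}, SmoothFn n → (Fin n → A) → A
  op_proj : ∀ {n : ℕ} (i : Fin n) (a : Fin n → A), op (SmoothFn.proj i) a = a i
  op_comp : ∀ {m n : ℕ} (f : SmoothFn n) (g : Fin n → SmoothFn m) (a : Fin m → A),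
    op (f.comp g) a = op f (fun i => op (g i) a)

namespace CInfRing

section ring
variable {A : Type u} [CInfRing A]

/-- The underlying ring operations. -/
def zero : A := op (SmoothFn.const 0 0) ![]
def one : A := op (SmoothFn.const 0 1) ![]
def add (a b : A) : A := op ((SmoothFn.proj 0).add (SmoothFn.proj 1)) ![a, b]
def mul (a b : A) : A := op ((SmoothFn.proj 0).mul (SmoothFn.proj 1)) ![a, b]
def neg (a : A) : A := op (SmoothFn.proj 0).neg ![a]

theorem op_const {n : ℕ} (r : ℝ) (a : Fin n → A) :
    op (SmoothFn.const n r) a = op (SmoothFn.const 0 r) ![] := by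
  have := op_comp (SmoothFn.const 0 r) (fun i : Fin 0 => i.elim0) a
  rw [show (fun i : Fin 0 => op (i.elim0 : SmoothFn n) a) = ![] from funext fun i => i.elim0] at this
  exact this

theorem add_op {n : ℕ} (f g : SmoothFn n) (a : Fin n → A) :
    add (op f a) (op g a) = op (f.add g) a := by
  have := op_comp ((SmoothFn.proj 0).add (SmoothFn.proj 1)) ![f, g] a
  rw [show (fun i => op (![f, g] i) a) = ![op f a, op g a] from
    funext fun i => by fin_cases i <;> rfl] at this
  exact this.symm

theorem mul_op {n : ℕ} (f g : SmoothFn n) (a : Fin n → A) :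
    mul (op f a) (op g a) = op (f.mul g) a := by
  have := op_comp ((SmoothFn.proj 0).mul (SmoothFn.proj 1)) ![f, g] a
  rw [show (fun i => op (![f, g] i) a) = ![op f a, op g a] from
    funext fun i => by fin_cases i <;> rfl] at this
  exact this.symm

theorem neg_op {n : ℕ} (f : SmoothFn n) (a : Fin n → A) :
    neg (op f a) = op f.neg a := by
  have := op_comp ((SmoothFn.proj 0).neg) ![f] a
  rw [show (fun i => op (![f] i) a) = ![op f a] from
    funext fun i => by fin_cases i; rfl] at this
  exact this.symm

theorem zero_op {n : ℕ} (a : Fin n → A) : (zero : A) = op (SmoothFn.const n 0) a :=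
  (op_const 0 a).symm

theorem one_op {n : ℕ} (a : Fin n → A) : (one : A) = op (SmoothFn.const n 1) a :=
  (op_const 1 a).symm

/-- Any three elements are the values of the coordinate functions. -/
theorem exists_three (a b c : A) : ∃ v : Fin 3 → A, a = op (SmoothFn.proj 0) v ∧
    b = op (SmoothFn.proj 1) v ∧ c = op (SmoothFn.proj 2) v :=
  ⟨![a, b, c], by simp [op_proj], by simp [op_proj], by simp [op_proj]⟩

/-- The underlying commutative ring of a `C^∞`-ring. -/
instance instCommRing : CommRing A where
  zero := zero
  one := one
  add := add
  mul := mul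
  neg := neg
  nsmul := @nsmulRec A ⟨zero⟩ ⟨add⟩
  zsmul := @zsmulRec A ⟨zero⟩ ⟨add⟩ ⟨neg⟩ (@nsmulRec A ⟨zero⟩ ⟨add⟩)
  add_assoc a b c := by
    obtain ⟨v, rfl, rfl, rfl⟩ := exists_three a b c
    change add (add _ _) _ = add _ (add _ _)
    simp only [add_op]
    exact congrArg (fun f => op f v) (SmoothFn.ext' fun x => by simp only [SmoothFn.add]; ring)
  zero_add a := by
    obtain ⟨v, rfl, -, -⟩ := exists_three a a a
    change add zero _ = _
    simp only [zero_op v, add_op]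
    exact congrArg (fun f => op f v)
      (SmoothFn.ext' fun x => by simp only [SmoothFn.add, SmoothFn.const]; ring)
  add_zero a := by
    obtain ⟨v, rfl, -, -⟩ := exists_three a a a
    change add _ zero = _
    simp only [zero_op v, add_op]
    exact congrArg (fun f => op f v)
      (SmoothFn.ext' fun x => by simp only [SmoothFn.add, SmoothFn.const]; ring)
  add_comm a b := by
    obtain ⟨v, rfl, rfl, -⟩ := exists_three a b a
    change add _ _ = add _ _
    simp only [add_op]
    exact congrArg (fun f => op f v) (SmoothFn.ext' fun x => by simp only [SmoothFn.add]; ring)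
  neg_add_cancel a := by
    obtain ⟨v, rfl, -, -⟩ := exists_three a a a
    change add (neg _) _ = zero
    simp only [zero_op v, add_op, neg_op]
    exact congrArg (fun f => op f v)
      (SmoothFn.ext' fun x => by simp only [SmoothFn.add, SmoothFn.const, SmoothFn.neg]; ring)
  mul_assoc a b c := by
    obtain ⟨v, rfl, rfl, rfl⟩ := exists_three a b c
    change mul (mul _ _) _ = mul _ (mul _ _)
    simp only [mul_op]
    exact congrArg (fun f => op f v) (SmoothFn.ext' fun x => by simp only [SmoothFn.mul]; ring)
  mul_comm a b := by
    obtain ⟨v, rfl, rfl, -⟩ := exists_three a b a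
    change mul _ _ = mul _ _
    simp only [mul_op]
    exact congrArg (fun f => op f v) (SmoothFn.ext' fun x => by simp only [SmoothFn.mul]; ring)
  one_mul a := by
    obtain ⟨v, rfl, -, -⟩ := exists_three a a a
    change mul one _ = _
    simp only [one_op v, mul_op]
    exact congrArg (fun f => op f v)
      (SmoothFn.ext' fun x => by simp only [SmoothFn.mul, SmoothFn.const]; ring)
  mul_one a := by
    obtain ⟨v, rfl, -, -⟩ := exists_three a a a
    change mul _ one = _
    simp only [one_op v, mul_op]
    exact congrArg (fun f => op f v)
      (SmoothFn.ext' fun x => by simp only [SmoothFn.mul, SmoothFn.const]; ring)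
  zero_mul a := by
    obtain ⟨v, rfl, -, -⟩ := exists_three a a a
    change mul zero _ = zero
    simp only [zero_op v, mul_op]
    exact congrArg (fun f => op f v)
      (SmoothFn.ext' fun x => by simp only [SmoothFn.mul, SmoothFn.const]; ring)
  mul_zero a := by
    obtain ⟨v, rfl, -, -⟩ := exists_three a a a
    change mul _ zero = zero
    simp only [zero_op v, mul_op]
    exact congrArg (fun f => op f v)
      (SmoothFn.ext' fun x => by simp only [SmoothFn.mul, SmoothFn.const]; ring)
  left_distrib a b c := by
    obtain ⟨v, rfl, rfl, rfl⟩ := exists_three a b c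
    change mul _ (add _ _) = add (mul _ _) (mul _ _)
    simp only [mul_op, add_op]
    exact congrArg (fun f => op f v)
      (SmoothFn.ext' fun x => by simp only [SmoothFn.mul, SmoothFn.add]; ring)
  right_distrib a b c := by
    obtain ⟨v, rfl, rfl, rfl⟩ := exists_three a b c
    change mul (add _ _) _ = add (mul _ _) (mul _ _)
    simp only [mul_op, add_op]
    exact congrArg (fun f => op f v)
      (SmoothFn.ext' fun x => by simp only [SmoothFn.mul, SmoothFn.add]; ring)

end ring

/-- The free `C^∞`-ring `C^∞(ℝⁿ)`. -/
instance (n : ℕ) : CInfRing (SmoothFn n) where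
  op f g := f.comp g
  op_proj _ _ := rfl
  op_comp _ _ _ := rfl

end CInfRing

/-- Morphisms of `C^∞`-rings. -/
@[ext]
structure CInfHom (A : Type u) (B : Type v) [CInfRing A] [CInfRing B] where
  toFun : A → B
  map_op' : ∀ {n : ℕ} (f : SmoothFn n) (a : Fin n → A),
    toFun (CInfRing.op f a) = CInfRing.op f (fun i => toFun (a i))

namespace CInfHom

variable {A : Type u} {B : Type v} {C : Type w} [CInfRing A] [CInfRing B] [CInfRing C]

instance : FunLike (CInfHom A B) A B where
  coe := toFun
  coe_injective f g h := by cases f; cases g; congr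

theorem map_op (φ : CInfHom A B) {n : ℕ} (f : SmoothFn n) (a : Fin n → A) :
    φ (CInfRing.op f a) = CInfRing.op f (fun i => φ (a i)) := φ.map_op' f a

def id (A : Type u) [CInfRing A] : CInfHom A A := ⟨fun a => a, fun _ _ => rfl⟩

def comp (ψ : CInfHom B C) (φ : CInfHom A B) : CInfHom A C :=
  ⟨fun a => ψ (φ a), fun f a => by rw [map_op, map_op]⟩

/-- The underlying ring homomorphism. -/
def toRingHom (φ : CInfHom A B) : A →+* B where
  toFun := φ
  map_zero' := (φ.map_op (SmoothFn.const 0 0) ![]).trans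
    (congrArg (CInfRing.op _) (funext fun i => i.elim0))
  map_one' := (φ.map_op (SmoothFn.const 0 1) ![]).trans
    (congrArg (CInfRing.op _) (funext fun i => i.elim0))
  map_add' a b := (φ.map_op _ ![a, b]).trans
    (congrArg (CInfRing.op _) (funext fun i => by fin_cases i <;> rfl))
  map_mul' a b := (φ.map_op _ ![a, b]).trans
    (congrArg (CInfRing.op _) (funext fun i => by fin_cases i <;> rfl))

instance : RingHomClass (CInfHom A B) A B where
  map_zero φ := φ.toRingHom.map_zero
  map_one φ := φ.toRingHom.map_one
  map_add φ := φ.toRingHom.map_add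
  map_mul φ := φ.toRingHom.map_mul

end CInfHom

/-- A `C^∞`-ring is finitely generated if it is a quotient of some `C^∞(ℝⁿ)`. -/
def IsFinGen (A : Type u) [CInfRing A] : Prop :=
  ∃ (n : ℕ) (φ : CInfHom (SmoothFn n) A), Function.Surjective φ

/-- A `C^∞`-ring is local if it has a unique maximal ideal, with residue field `ℝ`. -/
def IsLocalCInf (A : Type u) [CInfRing A] : Prop :=
  ∃ m : Ideal A, m.IsMaximal ∧ (∀ m' : Ideal A, m'.IsMaximal → m' = m) ∧
    Nonempty (A ⧸ m ≃+* ℝ)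

/-- The category of `C^∞`-rings. -/
structure CInfRingCat : Type (u + 1) where
  carrier : Type u
  [str : CInfRing carrier]

namespace CInfRingCat

instance : CoeSort CInfRingCat.{u} (Type u) := ⟨carrier⟩

instance (A : CInfRingCat.{u}) : CInfRing A := A.str

abbrev of (A : Type u) [CInfRing A] : CInfRingCat.{u} := ⟨A⟩

instance : Category CInfRingCat.{u} where
  Hom A B := CInfHom A B
  id A := CInfHom.id A
  comp f g := CInfHom.comp g f

instance : ConcreteCategory CInfRingCat.{u} (fun A B => CInfHom A B) where
  hom f := f
  ofHom f := f

theorem hom_ext {A B : CInfRingCat.{u}} {f g : A ⟶ B} (h : ∀ x : A, f x = g x) : f = g :=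
  CInfHom.ext (funext h)

end CInfRingCat

abbrev SCInfRing : Type (u + 1) := SimplicialObject CInfRingCat.{u}

namespace SCInfRing

variable {A B : SCInfRing.{u}}

/-- The totally degenerate `n`-simplex on a vertex. -/
def cst (v : A _⦋0⦌) (n : ℕ) : A _⦋n⦌ :=
  A.map (SimplexCategory.const ⦋n⦌ ⦋0⦌ 0).op v

/-- `n`-simplices of the underlying simplicial set all of whose faces are degenerate at `v`. -/
def IsSphere (v : A _⦋0⦌) (n : ℕ) : A _⦋n⦌ → Prop :=
  match n with
  | 0 => fun _ => True
  | n + 1 => fun x => ∀ i : Fin (n + 2), A.δ i x = cst v n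

def Sphere (v : A _⦋0⦌) (n : ℕ) : Type u := {x : A _⦋n⦌ // IsSphere v n x}

/-- Homotopy of spheres relative to the boundary: `x` and `y` are the last two faces of an
`(n+1)`-simplex whose other faces are degenerate at `v`. -/
def Sphere.Rel {v : A _⦋0⦌} {n : ℕ} (x y : Sphere v n) : Prop :=
  ∃ z : A _⦋n + 1⦌, A.δ (Fin.last n).castSucc z = x.1 ∧ A.δ (Fin.last (n + 1)) z = y.1 ∧
    ∀ i : Fin (n + 2), i < (Fin.last n).castSucc → A.δ i z = cst v n

/-- The `n`-th homotopy set `π_n(A, v)` of the underlying simplicial set (a Kan complex), based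
at the vertex `v`. -/
def Htpy (v : A _⦋0⦌) (n : ℕ) : Type u := Quot (Sphere.Rel (v := v) (n := n))

theorem δ_hom (f : A ⟶ B) {n : ℕ} (i : Fin (n + 2)) (x : A _⦋n + 1⦌) :
    f.app (op ⦋n⦌) (A.δ i x) = B.δ i (f.app (op ⦋n + 1⦌) x) :=
  ConcreteCategory.congr_hom (SimplicialObject.δ_naturality f i) x

theorem cst_hom (f : A ⟶ B) (v : A _⦋0⦌) (n : ℕ) :
    f.app (op ⦋n⦌) (cst v n) = cst (f.app (op ⦋0⦌) v) n :=
  ConcreteCategory.congr_hom (f.naturality (SimplexCategory.const ⦋n⦌ ⦋0⦌ 0).op) v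

def Sphere.map (f : A ⟶ B) {v : A _⦋0⦌} {w : B _⦋0⦌} (h : f.app (op ⦋0⦌) v = w) (n : ℕ)
    (x : Sphere v n) : Sphere w n :=
  ⟨f.app (op ⦋n⦌) x.1, by
    obtain ⟨x, hx⟩ := x
    cases n with
    | zero => trivial
    | succ n =>
      intro i
      rw [← δ_hom, hx i, cst_hom, h]⟩

/-- The map induced on homotopy sets by a morphism of simplicial `C^∞`-rings. -/
def Htpy.map (f : A ⟶ B) {v : A _⦋0⦌} {w : B _⦋0⦌} (h : f.app (op ⦋0⦌) v = w) (n : ℕ) :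
    Htpy v n → Htpy w n :=
  Quot.map (Sphere.map f h n) (by
    rintro x y ⟨z, h1, h2, h3⟩
    refine ⟨f.app _ z, ?_, ?_, fun i hi => ?_⟩
    · rw [← δ_hom, h1]; rfl
    · rw [← δ_hom, h2]; rfl
    · rw [← δ_hom, h3 i hi, cst_hom, h])

/-- A weak equivalence of simplicial `C^∞`-rings: the underlying map of simplicial sets induces
bijections on `π_0` and on all homotopy groups at all base points. -/
def IsWeakEquiv (f : A ⟶ B) : Prop :=
  ∀ (n : ℕ) (v : A _⦋0⦌), Function.Bijective (Htpy.map f (v := v) rfl n)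

/-! ### Homotopy at the base point `0` -/

theorem cst_zero (n : ℕ) : cst (0 : A _⦋0⦌) n = 0 := by
  unfold cst; rw [map_zero]

theorem δ_cst (v : A _⦋0⦌) {n : ℕ} (i : Fin (n + 2)) : A.δ i (cst v (n + 1)) = cst v n := by
  have := ConcreteCategory.congr_hom (A.map_comp (SimplexCategory.const ⦋n+1⦌ ⦋0⦌ 0).op
    (SimplexCategory.δ i).op) v
  rw [← op_comp] at this
  exact this.symm

theorem δ_σ_castSucc {n : ℕ} (i : Fin (n + 1)) (x : A _⦋n⦌) : A.δ i.castSucc (A.σ i x) = x :=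
  ConcreteCategory.congr_hom (A.δ_comp_σ_self (i := i)) x

theorem δ_σ_succ {n : ℕ} (i : Fin (n + 1)) (x : A _⦋n⦌) : A.δ i.succ (A.σ i x) = x :=
  ConcreteCategory.congr_hom (A.δ_comp_σ_succ (i := i)) x

/-- A degenerate simplex `σ j x` on a simplex `x` with vanishing faces has only two non-zero
faces. -/
theorem δ_σ_of_ne {n : ℕ} (j : Fin (n + 2)) (x : A _⦋n + 1⦌) (hx : ∀ i, A.δ i x = 0)
    (i : Fin (n + 3)) (h1 : i ≠ j.castSucc) (h2 : i ≠ j.succ) : A.δ i (A.σ j x) = 0 := by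
  rcases lt_or_gt_of_ne h1 with h | h
  · obtain ⟨j', rfl⟩ := Fin.exists_succ_eq.2 (show j ≠ 0 by rintro rfl; simp at h)
    obtain ⟨i', rfl⟩ := Fin.exists_castSucc_eq.2 (Fin.ne_last_of_lt h)
    have := ConcreteCategory.congr_hom (A.δ_comp_σ_of_le (i := i') (j := j') (by
      simpa [Fin.lt_def, Fin.le_def, Nat.lt_succ_iff] using h)) x
    refine this.trans ?_
    change A.σ j' (A.δ i' x) = 0
    rw [hx, map_zero]
  · have h' : j.succ < i := lt_of_le_of_ne (by simpa [Fin.lt_def, Fin.le_def] using h) (Ne.symm h2)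
    have := ConcreteCategory.congr_hom (A.δ_comp_σ_of_gt' h') x
    refine this.trans ?_
    change A.σ _ (A.δ _ x) = 0
    rw [hx, map_zero]

theorem isSphere_zero_iff {n : ℕ} (x : A _⦋n + 1⦌) :
    IsSphere (0 : A _⦋0⦌) (n + 1) x ↔ ∀ i, A.δ i x = 0 := by
  unfold IsSphere; simp only [cst_zero]

/-- The set `π_0` of a simplicial `C^∞`-ring. -/
abbrev Pi0 (A : SCInfRing.{u}) : Type u := Htpy (0 : A _⦋0⦌) 0

def Pi0.mk (x : A _⦋0⦌) : Pi0 A := Quot.mk _ ⟨x, trivial⟩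

theorem Pi0.mk_surjective : Function.Surjective (Pi0.mk (A := A)) := by
  rintro ⟨x, hx⟩; exact ⟨x, rfl⟩

/-- The relation on vertices given by the two faces of edges. -/
def Rel0 (x y : A _⦋0⦌) : Prop := ∃ z : A _⦋1⦌, A.δ 0 z = x ∧ A.δ 1 z = y

theorem rel0_iff (x y : Sphere (0 : A _⦋0⦌) 0) : Sphere.Rel x y ↔ Rel0 x.1 y.1 :=
  ⟨fun ⟨z, h1, h2, _⟩ => ⟨z, h1, h2⟩, fun ⟨z, h1, h2⟩ => ⟨z, h1, h2, fun i hi => absurd hi (by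
    simp)⟩⟩

theorem rel0_equivalence : Equivalence (Rel0 (A := A)) where
  refl x := ⟨A.σ 0 x, δ_σ_castSucc 0 x, δ_σ_succ 0 x⟩
  symm := by
    rintro x y ⟨z, rfl, rfl⟩
    refine ⟨A.σ 0 (A.δ 0 z) + A.σ 0 (A.δ 1 z) - z, ?_, ?_⟩
    · rw [map_sub, map_add]
      erw [δ_σ_castSucc 0, δ_σ_castSucc 0]
      ring
    · rw [map_sub, map_add]
      erw [δ_σ_succ 0, δ_σ_succ 0]
      ring
  trans := by
    rintro x y w ⟨z, rfl, rfl⟩ ⟨z', h, rfl⟩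
    refine ⟨z + z' - A.σ 0 (A.δ 1 z), ?_, ?_⟩
    · rw [map_sub, map_add, h]
      erw [δ_σ_castSucc 0]
      ring
    · rw [map_sub, map_add]
      erw [δ_σ_succ 0]
      ring

theorem Pi0.mk_eq_iff (x y : A _⦋0⦌) : Pi0.mk x = Pi0.mk y ↔ Rel0 x y := by
  constructor
  · intro h
    have := Quot.eqvGen_exact h
    have hE : Equivalence (Sphere.Rel (v := (0 : A _⦋0⦌)) (n := 0)) :=
      ⟨fun x => (rel0_iff _ _).2 (rel0_equivalence.refl _),
        fun h => (rel0_iff _ _).2 (rel0_equivalence.symm ((rel0_iff _ _).1 h)),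
        fun h h' => (rel0_iff _ _).2
          (rel0_equivalence.trans ((rel0_iff _ _).1 h) ((rel0_iff _ _).1 h'))⟩
    exact (rel0_iff _ _).1 (hE.eqvGen_iff.1 this)
  · intro h
    exact Quot.sound ((rel0_iff _ _).2 h)

noncomputable def Pi0.op {n : ℕ} (f : SmoothFn n) (t : Fin n → Pi0 A) : Pi0 A :=
  Pi0.mk (CInfRing.op f fun i => (Pi0.mk_surjective (t i)).choose)

theorem Pi0.op_mk {n : ℕ} (f : SmoothFn n) (x : Fin n → A _⦋0⦌) :
    Pi0.op f (fun i => Pi0.mk (x i)) = Pi0.mk (CInfRing.op f x) := by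
  refine (Pi0.mk_eq_iff _ _).2 ?_
  have h : ∀ i, Rel0 (Pi0.mk_surjective (Pi0.mk (x i))).choose (x i) := fun i =>
    (Pi0.mk_eq_iff _ _).1 (Pi0.mk_surjective (Pi0.mk (x i))).choose_spec
  choose z h0 h1 using h
  refine ⟨CInfRing.op f z, ?_, ?_⟩
  · refine (CInfHom.map_op (A.δ 0) f z).trans ?_
    exact congrArg (CInfRing.op f) (funext h0)
  · refine (CInfHom.map_op (A.δ 1) f z).trans ?_
    exact congrArg (CInfRing.op f) (funext h1)

/-- `π_0` is the quotient of the `C^∞`-ring of vertices by the `C^∞`-congruence of homotopy. -/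
noncomputable instance : CInfRing (Pi0 A) where
  op := Pi0.op
  op_proj i t := by
    choose x hx using fun i => Pi0.mk_surjective (t i)
    obtain rfl : (fun i => Pi0.mk (x i)) = t := funext hx
    rw [Pi0.op_mk, CInfRing.op_proj]
  op_comp f g t := by
    choose x hx using fun i => Pi0.mk_surjective (t i)
    obtain rfl : (fun i => Pi0.mk (x i)) = t := funext hx
    simp only [Pi0.op_mk, CInfRing.op_comp]

/-- The quotient map onto `π_0`. -/
noncomputable def Pi0.mkHom (A : SCInfRing.{u}) : CInfHom (A _⦋0⦌) (Pi0 A) :=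
  ⟨Pi0.mk, fun f a => (Pi0.op_mk f a).symm⟩

/-! The homotopy groups `π_{n+1}`. -/

variable {n : ℕ}

instance : Zero (Sphere (0 : A _⦋0⦌) (n + 1)) :=
  ⟨⟨0, (isSphere_zero_iff _).2 fun _ => map_zero _⟩⟩

instance : Add (Sphere (0 : A _⦋0⦌) (n + 1)) :=
  ⟨fun x y => ⟨x.1 + y.1, (isSphere_zero_iff _).2 fun i => by
    rw [map_add, (isSphere_zero_iff _).1 x.2, (isSphere_zero_iff _).1 y.2, add_zero]⟩⟩

instance : Neg (Sphere (0 : A _⦋0⦌) (n + 1)) :=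
  ⟨fun x => ⟨-x.1, (isSphere_zero_iff _).2 fun i => by
    rw [map_neg, (isSphere_zero_iff _).1 x.2, neg_zero]⟩⟩

/-- Vertices act on spheres through degeneracies and multiplication. -/
instance : SMul (A _⦋0⦌) (Sphere (0 : A _⦋0⦌) (n + 1)) :=
  ⟨fun a x => ⟨cst a _ * x.1, (isSphere_zero_iff _).2 fun i => by
    rw [map_mul, (isSphere_zero_iff _).1 x.2, mul_zero]⟩⟩

/-- Homotopy at the base point `0`, on simplices. -/
def RelZ (x y : A _⦋n + 1⦌) : Prop :=
  ∃ z : A _⦋n + 2⦌, A.δ (Fin.last (n + 1)).castSucc z = x ∧ A.δ (Fin.last (n + 2)) z = y ∧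
    ∀ i : Fin (n + 3), i < (Fin.last (n + 1)).castSucc → A.δ i z = 0

theorem rel_iff (x y : Sphere (0 : A _⦋0⦌) (n + 1)) : Sphere.Rel x y ↔ RelZ x.1 y.1 := by
  unfold Sphere.Rel RelZ; simp only [cst_zero]

theorem relZ_refl (x : A _⦋n + 1⦌) (hx : ∀ i, A.δ i x = 0) : RelZ x x :=
  ⟨A.σ (Fin.last _) x, δ_σ_castSucc _ x, δ_σ_succ (Fin.last _) x,
    fun i hi => δ_σ_of_ne _ x hx i hi.ne (by
      rintro rfl
      simp [Fin.lt_def] at hi)⟩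

theorem RelZ.add {x y x' y' : A _⦋n + 1⦌} (h : RelZ x y) (h' : RelZ x' y') :
    RelZ (x + x') (y + y') := by
  obtain ⟨z, h1, h2, h3⟩ := h
  obtain ⟨z', h1', h2', h3'⟩ := h'
  exact ⟨z + z', by rw [map_add, h1, h1'], by rw [map_add, h2, h2'],
    fun i hi => by rw [map_add, h3 i hi, h3' i hi, add_zero]⟩

theorem RelZ.neg {x y : A _⦋n + 1⦌} (h : RelZ x y) : RelZ (-x) (-y) := by
  obtain ⟨z, h1, h2, h3⟩ := h
  exact ⟨-z, by rw [map_neg, h1], by rw [map_neg, h2],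
    fun i hi => by rw [map_neg, h3 i hi, neg_zero]⟩

theorem RelZ.smul {x y : A _⦋n + 1⦌} (a : A _⦋0⦌) (h : RelZ x y) :
    RelZ (cst a _ * x) (cst a _ * y) := by
  obtain ⟨z, h1, h2, h3⟩ := h
  exact ⟨cst a _ * z, by rw [map_mul, h1, δ_cst], by rw [map_mul, h2, δ_cst],
    fun i hi => by rw [map_mul, h3 i hi, mul_zero]⟩

theorem RelZ.symm {x y : A _⦋n + 1⦌} (hx : ∀ i, A.δ i x = 0) (hy : ∀ i, A.δ i y = 0)
    (h : RelZ x y) : RelZ y x := by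
  have := ((relZ_refl x hx).add (relZ_refl y hy)).add h.neg
  convert this using 1 <;> ring

theorem RelZ.trans {x y w : A _⦋n + 1⦌} (hy : ∀ i, A.δ i y = 0)
    (h : RelZ x y) (h' : RelZ y w) : RelZ x w := by
  have := (h.add h').add (relZ_refl y hy).neg
  convert this using 1 <;> ring

/-- A simplex whose only non-zero faces are two adjacent ones gives a homotopy between them. -/
theorem relZ_of_adjacent (d : ℕ) : ∀ (j : Fin (n + 2)) (_ : j.1 + d = n + 1)
    (x y : A _⦋n + 1⦌) (_ : ∀ i, A.δ i x = 0) (_ : ∀ i, A.δ i y = 0) (z : A _⦋n + 2⦌)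
    (_ : A.δ j.castSucc z = x) (_ : A.δ j.succ z = y)
    (_ : ∀ i : Fin (n + 3), i ≠ j.castSucc → i ≠ j.succ → A.δ i z = 0), RelZ x y := by
  induction d with
  | zero =>
    intro j hj x y hx hy z h1 h2 h3
    obtain rfl : j = Fin.last (n + 1) := Fin.ext (by simpa using hj)
    exact ⟨z, h1, h2, fun i hi => h3 i hi.ne (by rintro rfl; simp [Fin.lt_def] at hi)⟩
  | succ d ih =>
    intro j hj x y hx hy z h1 h2 h3
    have hjl : j.1 + 1 < n + 2 := by omega
    let j' : Fin (n + 2) := ⟨j.1 + 1, hjl⟩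
    have hj' : j'.castSucc = j.succ := rfl
    have hyx : ∀ i, A.δ i (y - x) = 0 := fun i => by rw [map_sub, hx, hy, sub_zero]
    have hxy : ∀ i, A.δ i (x - y) = 0 := fun i => by rw [map_sub, hx, hy, sub_zero]
    have h0 : ∀ i, A.δ i (0 : A _⦋n + 1⦌) = 0 := fun i => map_zero _
    have key : RelZ (0 : A _⦋n + 1⦌) (x - y) := by
      refine ih j' (by simp only [j']; omega) 0 (x - y) h0 hxy
        (z - A.σ j x - A.σ j' (y - x)) ?_ ?_ ?_
      · rw [map_sub, map_sub, δ_σ_castSucc, hj', h2, δ_σ_succ, sub_self]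
      · rw [map_sub, map_sub, δ_σ_succ, h3, δ_σ_of_ne j x hx]
        · ring
        · simp only [Fin.ext_iff, j', ne_eq, Fin.val_succ, Fin.val_castSucc]; omega
        · simp [Fin.ext_iff, j']
        · simp only [Fin.ext_iff, j', ne_eq, Fin.val_succ, Fin.val_castSucc]; omega
        · simp [Fin.ext_iff, j']
      · intro i hi1 hi2
        rw [map_sub, map_sub, δ_σ_of_ne j' _ hyx i hi1 hi2, sub_zero]
        by_cases hi : i = j.castSucc
        · subst hi
          rw [h1, δ_σ_castSucc, sub_self]
        · rw [h3 i hi (hj' ▸ hi1), δ_σ_of_ne j x hx i hi (hj' ▸ hi1), sub_zero]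
    have := (key.symm h0 hxy).add (relZ_refl y hy)
    simpa using this

/-- The map `[m] → [1]` sending exactly the elements below `j` to `0`. -/
def threshold (m j : ℕ) : ⦋m⦌ ⟶ ⦋1⦌ :=
  SimplexCategory.Hom.mk ⟨fun i : Fin (m + 1) => if i.1 < j then (0 : Fin 2) else 1, by
    intro a b hab
    have hab' : a.1 ≤ b.1 := hab
    dsimp only
    split_ifs <;> first | omega | simp⟩

theorem δ_threshold_low (m : ℕ) (j : Fin (m + 1)) :
    SimplexCategory.δ j.castSucc ≫ threshold (m + 1) (j.1 + 1) = threshold m j.1 := by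
  ext i : 3
  change (if (j.castSucc.succAbove i).1 < j.1 + 1 then (0 : Fin 2) else 1) =
    if i.1 < j.1 then 0 else 1
  have : (j.castSucc.succAbove i).1 = if i.1 < j.1 then i.1 else i.1 + 1 := by
    simp only [Fin.succAbove, Fin.lt_def, Fin.val_castSucc]
    split_ifs <;> rfl
  rw [this]
  split_ifs <;> omega

theorem δ_threshold_high (m : ℕ) (j : Fin (m + 1)) :
    SimplexCategory.δ j.succ ≫ threshold (m + 1) (j.1 + 1) = threshold m (j.1 + 1) := by
  ext i : 3
  change (if (j.succ.succAbove i).1 < j.1 + 1 then (0 : Fin 2) else 1) =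
    if i.1 < j.1 + 1 then 0 else 1
  have : (j.succ.succAbove i).1 = if i.1 < j.1 + 1 then i.1 else i.1 + 1 := by
    simp only [Fin.succAbove, Fin.lt_def, Fin.val_castSucc, Fin.val_succ]
    split_ifs <;> rfl
  rw [this]
  split_ifs <;> omega

theorem map_threshold_zero (h : A _⦋1⦌) (m : ℕ) :
    A.map (threshold m 0).op h = cst (A.δ 0 h) m := by
  have e : SimplexCategory.const ⦋m⦌ ⦋0⦌ 0 ≫ SimplexCategory.δ (0 : Fin 2) = threshold m 0 := by
    ext i : 3
    rfl
  rw [← e, op_comp, A.map_comp]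
  rfl

theorem map_threshold_last (h : A _⦋1⦌) (m : ℕ) :
    A.map (threshold m (m + 1)).op h = cst (A.δ 1 h) m := by
  have e : SimplexCategory.const ⦋m⦌ ⦋0⦌ 0 ≫ SimplexCategory.δ (1 : Fin 2) =
      threshold m (m + 1) := by
    ext i : 3
    change (0 : Fin 2) = if i.1 < m + 1 then 0 else 1
    rw [if_pos i.2]
  rw [← e, op_comp, A.map_comp]
  rfl

theorem δ_map_threshold_low (h : A _⦋1⦌) (m : ℕ) (j : Fin (m + 1)) :
    A.δ j.castSucc (A.map (threshold (m + 1) (j.1 + 1)).op h) = A.map (threshold m j.1).op h := by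
  rw [← δ_threshold_low, op_comp, A.map_comp]
  rfl

theorem δ_map_threshold_high (h : A _⦋1⦌) (m : ℕ) (j : Fin (m + 1)) :
    A.δ j.succ (A.map (threshold (m + 1) (j.1 + 1)).op h) =
      A.map (threshold m (j.1 + 1)).op h := by
  rw [← δ_threshold_high, op_comp, A.map_comp]
  rfl

/-- Homotopic vertices act on spheres in the same way up to homotopy. -/
theorem relZ_smul_of_rel0 {a b : A _⦋0⦌} (hab : Rel0 a b) (x : A _⦋n + 1⦌)
    (hx : ∀ i, A.δ i x = 0) : RelZ (cst a _ * x) (cst b _ * x) := by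
  obtain ⟨h, rfl, rfl⟩ := hab
  have hs : ∀ (c : A _⦋n + 1⦌) (i), A.δ i (c * x) = 0 := fun c i => by
    rw [map_mul, hx, mul_zero]
  have step : ∀ j : Fin (n + 2), RelZ (A.map (threshold (n + 1) j.1).op h * x)
      (A.map (threshold (n + 1) (j.1 + 1)).op h * x) := fun j => by
    refine relZ_of_adjacent (n + 1 - j.1) j (by omega) _ _ (hs _) (hs _)
      (A.map (threshold (n + 2) (j.1 + 1)).op h * A.σ j x) ?_ ?_ fun i h1 h2 => ?_
    · rw [map_mul, δ_map_threshold_low, δ_σ_castSucc]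
    · rw [map_mul, δ_map_threshold_high, δ_σ_succ]
    · rw [map_mul, δ_σ_of_ne j x hx i h1 h2, mul_zero]
  have main : ∀ j : ℕ, j ≤ n + 2 → RelZ (A.map (threshold (n + 1) 0).op h * x)
      (A.map (threshold (n + 1) j).op h * x) := by
    intro j
    induction j with
    | zero => exact fun _ => relZ_refl _ (hs _)
    | succ j ih => exact fun hj => (ih (by omega)).trans (hs _) (step ⟨j, by omega⟩)
  have := main (n + 2) le_rfl
  rwa [map_threshold_zero, map_threshold_last] at this

/-- The homotopy group `π_{n+1}` at the base point `0`. -/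
abbrev PiSucc (A : SCInfRing.{u}) (n : ℕ) : Type u := Htpy (0 : A _⦋0⦌) (n + 1)

theorem faces (x : Sphere (0 : A _⦋0⦌) (n + 1)) : ∀ i, A.δ i x.1 = 0 :=
  (isSphere_zero_iff _).1 x.2

def PiSucc.mk (x : Sphere (0 : A _⦋0⦌) (n + 1)) : PiSucc A n := Quot.mk _ x

theorem PiSucc.mk_surjective : Function.Surjective (PiSucc.mk (A := A) (n := n)) := by
  rintro ⟨x⟩; exact ⟨x, rfl⟩

instance : Zero (PiSucc A n) := ⟨PiSucc.mk 0⟩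

instance : Add (PiSucc A n) :=
  ⟨Quot.map₂ (· + ·)
    (fun x _ _ h => (rel_iff _ _).2 ((relZ_refl x.1 (faces x)).add ((rel_iff _ _).1 h)))
    (fun _ _ y h => (rel_iff _ _).2 (((rel_iff _ _).1 h).add (relZ_refl y.1 (faces y))))⟩

instance : Neg (PiSucc A n) :=
  ⟨Quot.map (- ·) (fun _ _ h => (rel_iff _ _).2 ((rel_iff _ _).1 h).neg)⟩

theorem PiSucc.mk_add (x y : Sphere (0 : A _⦋0⦌) (n + 1)) :
    PiSucc.mk (x + y) = PiSucc.mk x + PiSucc.mk y := rfl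

theorem PiSucc.mk_neg (x : Sphere (0 : A _⦋0⦌) (n + 1)) : PiSucc.mk (-x) = -PiSucc.mk x := rfl

theorem PiSucc.mk_zero : PiSucc.mk (0 : Sphere (0 : A _⦋0⦌) (n + 1)) = 0 := rfl

/-- The group structure on `π_{n+1}`, induced by addition of simplices. -/
instance : AddCommGroup (PiSucc A n) where
  add_assoc := by
    rintro ⟨x⟩ ⟨y⟩ ⟨z⟩; exact congrArg PiSucc.mk (Subtype.ext (add_assoc x.1 y.1 z.1))
  zero_add := by rintro ⟨x⟩; exact congrArg PiSucc.mk (Subtype.ext (zero_add x.1))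
  add_zero := by rintro ⟨x⟩; exact congrArg PiSucc.mk (Subtype.ext (add_zero x.1))
  add_comm := by rintro ⟨x⟩ ⟨y⟩; exact congrArg PiSucc.mk (Subtype.ext (add_comm x.1 y.1))
  neg_add_cancel := by
    rintro ⟨x⟩; exact congrArg PiSucc.mk (Subtype.ext (neg_add_cancel x.1))
  nsmul := nsmulRec
  zsmul := zsmulRec

instance : SMul (Pi0 A) (PiSucc A n) :=
  ⟨Quot.map₂ (fun a x => a.1 • x)
    (fun a _ _ h => (rel_iff _ _).2 (((rel_iff _ _).1 h).smul a.1))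
    (fun a b x h => (rel_iff (a.1 • x) (b.1 • x)).2
      (relZ_smul_of_rel0 ((rel0_iff _ _).1 h) x.1 (faces x)))⟩

theorem PiSucc.mk_smul (a : A _⦋0⦌) (x : Sphere (0 : A _⦋0⦌) (n + 1)) :
    PiSucc.mk (a • x) = Pi0.mk a • PiSucc.mk x := rfl

theorem Pi0.mk_add (a b : A _⦋0⦌) : Pi0.mk (a + b) = Pi0.mk a + Pi0.mk b :=
  map_add (Pi0.mkHom A) a b
theorem Pi0.mk_mul (a b : A _⦋0⦌) : Pi0.mk (a * b) = Pi0.mk a * Pi0.mk b :=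
  map_mul (Pi0.mkHom A) a b
theorem Pi0.mk_one : Pi0.mk (1 : A _⦋0⦌) = 1 := map_one (Pi0.mkHom A)
theorem Pi0.mk_zero : Pi0.mk (0 : A _⦋0⦌) = 0 := map_zero (Pi0.mkHom A)

/-- `π_{n+1}` is a module over `π_0`. -/
instance : Module (Pi0 A) (PiSucc A n) where
  one_smul x := by
    obtain ⟨x, rfl⟩ := PiSucc.mk_surjective x
    rw [← Pi0.mk_one, ← PiSucc.mk_smul]
    exact congrArg PiSucc.mk (Subtype.ext (by
      change A.map _ 1 * x.1 = x.1
      rw [map_one, one_mul]))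
  mul_smul a b x := by
    obtain ⟨x, rfl⟩ := PiSucc.mk_surjective x
    obtain ⟨a, rfl⟩ := Pi0.mk_surjective a
    obtain ⟨b, rfl⟩ := Pi0.mk_surjective b
    rw [← Pi0.mk_mul, ← PiSucc.mk_smul, ← PiSucc.mk_smul, ← PiSucc.mk_smul]
    exact congrArg PiSucc.mk (Subtype.ext (by
      change A.map _ (a * b) * x.1 = A.map _ a * (A.map _ b * x.1)
      rw [map_mul, mul_assoc]))
  smul_zero a := by
    obtain ⟨a, rfl⟩ := Pi0.mk_surjective a
    exact congrArg PiSucc.mk (Subtype.ext (mul_zero _))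
  smul_add a x y := by
    obtain ⟨x, rfl⟩ := PiSucc.mk_surjective x
    obtain ⟨y, rfl⟩ := PiSucc.mk_surjective y
    obtain ⟨a, rfl⟩ := Pi0.mk_surjective a
    exact congrArg PiSucc.mk (Subtype.ext (mul_add _ _ _))
  add_smul a b x := by
    obtain ⟨x, rfl⟩ := PiSucc.mk_surjective x
    obtain ⟨a, rfl⟩ := Pi0.mk_surjective a
    obtain ⟨b, rfl⟩ := Pi0.mk_surjective b
    rw [← Pi0.mk_add, ← PiSucc.mk_smul, ← PiSucc.mk_smul, ← PiSucc.mk_smul, ← PiSucc.mk_add]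
    exact congrArg PiSucc.mk (Subtype.ext (by
      change A.map _ (a + b) * x.1 = A.map _ a * x.1 + A.map _ b * x.1
      rw [map_add, add_mul]))
  zero_smul x := by
    obtain ⟨x, rfl⟩ := PiSucc.mk_surjective x
    rw [← Pi0.mk_zero, ← PiSucc.mk_smul, ← PiSucc.mk_zero]
    exact congrArg PiSucc.mk (Subtype.ext (by
      change A.map _ 0 * x.1 = 0
      rw [map_zero, zero_mul]))

theorem app_zero (f : A ⟶ B) : f.app (op ⦋0⦌) (0 : A _⦋0⦌) = (0 : B _⦋0⦌) := map_zero _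

/-- The homotopy sets at the base point `0`, as functors. -/
def pi (n : ℕ) : SCInfRing.{u} ⥤ Type u where
  obj A := Htpy (0 : A _⦋0⦌) n
  map f := ↾(Htpy.map f (app_zero f) n)
  map_id A := by
    ext ⟨x⟩
    rfl
  map_comp f g := by
    ext ⟨x⟩
    rfl

/-- `π_0` as a functor to `C^∞`-rings. -/
noncomputable def pi0 : SCInfRing.{u} ⥤ CInfRingCat.{u} where
  obj A := CInfRingCat.of (Pi0 A)
  map {A B} f :=
    { toFun := Htpy.map f (app_zero f) 0
      map_op' := fun {k} F t => by
        choose x hx using fun i => Pi0.mk_surjective (t i)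
        obtain rfl : (fun i => Pi0.mk (x i)) = t := funext hx
        change Htpy.map f (app_zero f) 0 (Pi0.op F _) = Pi0.op F (fun i => Pi0.mk (f.app _ (x i)))
        rw [Pi0.op_mk, Pi0.op_mk]
        exact congrArg Pi0.mk (CInfHom.map_op (f.app (op ⦋0⦌)) F x) }
  map_id A := by
    apply CInfRingCat.hom_ext
    rintro ⟨x⟩
    rfl
  map_comp f g := by
    apply CInfRingCat.hom_ext
    rintro ⟨x⟩
    rfl


theorem PiSucc.map_add (f : A ⟶ B) (x y : PiSucc A n) : Htpy.map f (app_zero f) (n + 1) (x + y) =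
    (Htpy.map f (app_zero f) (n + 1) x + Htpy.map f (app_zero f) (n + 1) y : PiSucc B n) := by
  obtain ⟨x, rfl⟩ := PiSucc.mk_surjective x
  obtain ⟨y, rfl⟩ := PiSucc.mk_surjective y
  exact congrArg PiSucc.mk (Subtype.ext (_root_.map_add (f.app (op ⦋n + 1⦌)).toRingHom x.1 y.1))

theorem PiSucc.map_neg (f : A ⟶ B) (x : PiSucc A n) : Htpy.map f (app_zero f) (n + 1) (-x) =
    (-Htpy.map f (app_zero f) (n + 1) x : PiSucc B n) := by
  obtain ⟨x, rfl⟩ := PiSucc.mk_surjective x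
  exact congrArg PiSucc.mk (Subtype.ext (_root_.map_neg (f.app (op ⦋n + 1⦌)).toRingHom x.1))

theorem PiSucc.map_zero (f : A ⟶ B) : Htpy.map f (app_zero f) (n + 1) (0 : PiSucc A n) =
    (0 : PiSucc B n) :=
  congrArg PiSucc.mk (Subtype.ext (_root_.map_zero (f.app (op ⦋n + 1⦌)).toRingHom))

theorem PiSucc.map_smul (f : A ⟶ B) (a : Pi0 A) (x : PiSucc A n) :
    Htpy.map f (app_zero f) (n + 1) (a • x) =
    (Htpy.map f (app_zero f) 0 a • Htpy.map f (app_zero f) (n + 1) x : PiSucc B n) := by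
  obtain ⟨x, rfl⟩ := PiSucc.mk_surjective x
  obtain ⟨a, rfl⟩ := Pi0.mk_surjective a
  refine congrArg PiSucc.mk (Subtype.ext ?_)
  change f.app (op ⦋n + 1⦌) (cst a _ * x.1) = cst (f.app _ a) _ * f.app (op ⦋n + 1⦌) x.1
  rw [map_mul, cst_hom]

end SCInfRing

/-! ### Sheafification of presheaves with algebraic structure -/

section Sheafification

open TopCat

variable {X : TopCat.{u}}

section ops
variable (F G H : Presheaf (Type u) X)

theorem exists_common {F G : Presheaf (Type u) X} {x : X} (s : F.stalk x) (t : G.stalk x) :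
    ∃ (U : Opens X) (hx : x ∈ U) (a : F.obj (op U)) (b : G.obj (op U)),
      F.germ U x hx a = s ∧ G.germ U x hx b = t := by
  obtain ⟨U, hU, a, rfl⟩ := F.exists_germ_eq s
  obtain ⟨V, hV, b, rfl⟩ := G.exists_germ_eq t
  exact ⟨U ⊓ V, ⟨hU, hV⟩, F.map (homOfLE inf_le_left).op a, G.map (homOfLE inf_le_right).op b,
    F.germ_res_apply _ _ _ _, G.germ_res_apply _ _ _ _⟩

theorem exists_common_fin {F : Presheaf (Type u) X} {x : X} {n : ℕ} (s : Fin n → F.stalk x) :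
    ∃ (U : Opens X) (hx : x ∈ U) (a : Fin n → F.obj (op U)), ∀ i, F.germ U x hx (a i) = s i := by
  choose U hU a ha using fun i => F.exists_germ_eq (s i)
  refine ⟨⟨⋂ i, (U i : Set X), isOpen_iInter_of_finite fun i => (U i).2⟩,
    Set.mem_iInter.2 hU,
    fun i => F.map (homOfLE (Set.iInter_subset (fun i => (U i : Set X)) i)).op (a i), fun i => ?_⟩
  rw [← ha i]
  exact F.germ_res_apply _ _ _ _

/-- The operation induced on stalks by a natural binary operation. -/
noncomputable def stalkMap₂ {F G H : Presheaf (Type u) X}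
    (μ : ∀ U : Opens X, F.obj (op U) → G.obj (op U) → H.obj (op U)) {x : X}
    (s : F.stalk x) (t : G.stalk x) : H.stalk x :=
  H.germ _ x (exists_common s t).choose_spec.choose
    (μ _ (exists_common s t).choose_spec.choose_spec.choose
      (exists_common s t).choose_spec.choose_spec.choose_spec.choose)

def IsNatural₂ {F G H : Presheaf (Type u) X}
    (μ : ∀ U : Opens X, F.obj (op U) → G.obj (op U) → H.obj (op U)) : Prop :=
  ∀ ⦃U V : Opens X⦄ (i : U ⟶ V) (a : F.obj (op V)) (b : G.obj (op V)),
    H.map i.op (μ V a b) = μ U (F.map i.op a) (G.map i.op b)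

theorem stalkMap₂_germ {F G H : Presheaf (Type u) X}
    {μ : ∀ U : Opens X, F.obj (op U) → G.obj (op U) → H.obj (op U)} (hμ : IsNatural₂ μ) {x : X}
    {U : Opens X} (hx : x ∈ U) (a : F.obj (op U)) (b : G.obj (op U)) :
    stalkMap₂ μ (F.germ U x hx a) (G.germ U x hx b) = H.germ U x hx (μ U a b) := by
  have h := exists_common (F.germ U x hx a) (G.germ U x hx b)
  obtain ⟨ha, hb⟩ := h.choose_spec.choose_spec.choose_spec.choose_spec
  obtain ⟨W, hW, i, j, e⟩ := F.germ_eq x _ _ _ _ ha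
  obtain ⟨W', hW', i', j', e'⟩ := G.germ_eq x _ _ _ _ hb
  refine H.germ_ext (W ⊓ W') ⟨hW, hW'⟩ (homOfLE inf_le_left ≫ i) (homOfLE inf_le_left ≫ j) ?_
  rw [hμ, hμ]
  congr 1
  · rw [op_comp, op_comp, F.map_comp, F.map_comp]
    exact congrArg (F.map (homOfLE inf_le_left).op) e
  · rw [Subsingleton.elim (homOfLE inf_le_left ≫ i) (homOfLE inf_le_right ≫ i'),
      Subsingleton.elim (homOfLE inf_le_left ≫ j) (homOfLE inf_le_right ≫ j'),
      op_comp, op_comp, G.map_comp, G.map_comp]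
    exact congrArg (G.map (homOfLE inf_le_right).op) e'

/-- The sections over `U` of the sheaf associated to `F`: families of germs which are locally
induced by sections of `F`. -/
abbrev Sec (F : Presheaf (Type u) X) (U : Opens X) : Type u := F.sheafify.1.obj (op U)

theorem Sec.exists_germ {F : Presheaf (Type u) X} {U : Opens X} (s : Sec F U) (x : X) (hx : x ∈ U) :
    ∃ (V : Opens X) (_ : x ∈ V) (i : V ⟶ U) (g : F.obj (op V)),
      ∀ (y : X) (hy : y ∈ V), s.1 ⟨y, i.le hy⟩ = F.germ V y hy g := by
  obtain ⟨V, hV, i, g, h⟩ := s.2 ⟨x, hx⟩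
  exact ⟨V, hV, i, g, fun y hy => h ⟨y, hy⟩⟩

def Sec.mk {F : Presheaf (Type u) X} {U : Opens X} (f : ∀ x : U, F.stalk x.1)
    (hf : ∀ (x : X) (_ : x ∈ U), ∃ (V : Opens X) (_ : x ∈ V) (i : V ⟶ U) (g : F.obj (op V)),
      ∀ (y : X) (hy : y ∈ V), f ⟨y, i.le hy⟩ = F.germ V y hy g) : Sec F U :=
  ⟨f, fun x => by
    obtain ⟨V, hV, i, g, h⟩ := hf x.1 x.2
    exact ⟨V, hV, i, g, fun y => h y.1 y.2⟩⟩

noncomputable def Sec.map₂ {F G H : Presheaf (Type u) X}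
    {μ : ∀ U : Opens X, F.obj (op U) → G.obj (op U) → H.obj (op U)} (hμ : IsNatural₂ μ)
    {U : Opens X} (s : Sec F U) (t : Sec G U) : Sec H U :=
  Sec.mk (fun x => stalkMap₂ μ (s.1 x) (t.1 x)) (fun x hx => by
    obtain ⟨V, hV, i, g, h⟩ := s.exists_germ x hx
    obtain ⟨V', hV', i', g', h'⟩ := t.exists_germ x hx
    refine ⟨V ⊓ V', ⟨hV, hV'⟩, homOfLE inf_le_left ≫ i,
      μ _ (F.map (homOfLE inf_le_left).op g) (G.map (homOfLE inf_le_right).op g'),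
      fun y hy => ?_⟩
    rw [← stalkMap₂_germ hμ, F.germ_res_apply, G.germ_res_apply]
    exact congrArg₂ (stalkMap₂ μ) (h y hy.1) (h' y hy.2))

end ops

/-! Presheaves of `C^∞`-rings. -/

section CInf
variable (Q : Presheaf CInfRingCat.{u} X)

/-- The underlying presheaf of sets. -/
abbrev under : Presheaf (Type u) X := Q ⋙ forget CInfRingCat.{u}

variable {Q}

noncomputable def stalkOp {x : X} {n : ℕ} (f : SmoothFn n) (s : Fin n → (under Q).stalk x) :
    (under Q).stalk x :=
  (under Q).germ _ x (exists_common_fin s).choose_spec.choose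
    (CInfRing.op (A := Q.obj _) f (exists_common_fin s).choose_spec.choose_spec.choose)

theorem stalkOp_germ {x : X} {n : ℕ} (f : SmoothFn n) {U : Opens X} (hx : x ∈ U)
    (a : Fin n → Q.obj (op U)) :
    stalkOp f (fun i => (under Q).germ U x hx (a i)) =
      (under Q).germ U x hx (CInfRing.op (A := Q.obj (op U)) f a) := by
  have h := exists_common_fin (fun i => (under Q).germ U x hx (a i))
  have ha := h.choose_spec.choose_spec.choose_spec
  choose W hW i j e using fun k => (under Q).germ_eq x _ _ _ _ (ha k)
  let W' : Opens X := ⟨(⋂ k, (W k : Set X)) ∩ h.choose ∩ U,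
    ((isOpen_iInter_of_finite fun k => (W k).2).inter h.choose.2).inter U.2⟩
  have hWW : ∀ k, W' ≤ W k := fun k y hy => Set.mem_iInter.1 hy.1.1 k
  refine (under Q).germ_ext W' ⟨⟨Set.mem_iInter.2 hW, h.choose_spec.choose⟩, hx⟩
    (homOfLE fun y hy => hy.1.2) (homOfLE fun y hy => hy.2) ?_
  refine (CInfHom.map_op (Q.map _) f _).trans (Eq.trans ?_ (CInfHom.map_op (Q.map _) f _).symm)
  refine congrArg (CInfRing.op f) (funext fun k => ?_)
  have := congrArg ((under Q).map (homOfLE (hWW k)).op) (e k)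
  rw [← types_comp_apply, ← types_comp_apply ((under Q).map (j k).op), ← (under Q).map_comp,
    ← (under Q).map_comp] at this
  exact this

noncomputable instance (x : X) : CInfRing ((under Q).stalk x) where
  op := stalkOp
  op_proj i t := by
    obtain ⟨U, hx, a, ha⟩ := exists_common_fin t
    obtain rfl := funext ha
    rw [stalkOp_germ, CInfRing.op_proj]
  op_comp f g t := by
    obtain ⟨U, hx, a, ha⟩ := exists_common_fin t
    obtain rfl := funext ha
    rw [stalkOp_germ, CInfRing.op_comp, ← stalkOp_germ]
    exact congrArg (stalkOp f) (funext fun i => (stalkOp_germ (g i) hx a).symm)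

noncomputable def secOp {U : Opens X} {n : ℕ} (f : SmoothFn n) (s : Fin n → Sec (under Q) U) :
    Sec (under Q) U :=
  Sec.mk (fun x => CInfRing.op f fun i => (s i).1 x) (fun x hx => by
    choose V hV i g h using fun k => (s k).exists_germ x hx
    let W : Opens X := ⟨(⋂ k, (V k : Set X)) ∩ U,
      (isOpen_iInter_of_finite fun k => (V k).2).inter U.2⟩
    have hW : ∀ k, W ≤ V k := fun k y hy => Set.mem_iInter.1 hy.1 k
    refine ⟨W, ⟨Set.mem_iInter.2 hV, hx⟩, homOfLE fun y hy => hy.2,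
      CInfRing.op (A := Q.obj (op W)) f fun k => (under Q).map (homOfLE (hW k)).op (g k),
      fun y hy => ?_⟩
    refine Eq.trans ?_ (stalkOp_germ (Q := Q) f hy _)
    refine congrArg (stalkOp f) (funext fun k => ?_)
    rw [(under Q).germ_res_apply]
    exact h k y (hW k hy))

/-- The sections of the associated sheaf form a `C^∞`-ring, with operations computed on germs. -/
noncomputable instance (U : Opens X) : CInfRing (Sec (under Q) U) where
  op := secOp
  op_proj i t := Subtype.ext (funext fun x => CInfRing.op_proj i fun k => (t k).1 x)
  op_comp f g t := Subtype.ext (funext fun x => CInfRing.op_comp f g fun k => (t k).1 x)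

variable (Q)

/-- The sheaf of `C^∞`-rings associated to a presheaf of `C^∞`-rings. -/
noncomputable def assocSheaf : Presheaf CInfRingCat.{u} X where
  obj U := CInfRingCat.of (Sec (under Q) U.unop)
  map i := { toFun := (under Q).sheafify.1.map i, map_op' := fun _ _ => rfl }
  map_id _ := rfl
  map_comp _ _ := rfl

/-- The canonical morphism to the associated sheaf. -/
noncomputable def toAssocSheaf : Q ⟶ assocSheaf Q where
  app U :=
    { toFun := (under Q).toSheafify.app U
      map_op' := fun f a => Subtype.ext (funext fun x => (stalkOp_germ f x.2 a).symm) }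
  naturality _ _ i := CInfRingCat.hom_ext fun x =>
    ConcreteCategory.congr_hom ((under Q).toSheafify.naturality i) x

end CInf

/-! The sheaves of homotopy groups of a presheaf of simplicial `C^∞`-rings. -/

section Modules

variable (P : Presheaf SCInfRing.{u} X)

/-- The presheaf `U ↦ π_n(P(U))`. -/
abbrev piPre (n : ℕ) : Presheaf (Type u) X := P ⋙ SCInfRing.pi n

/-- The associated sheaf of sets of `U ↦ π_n(P(U))`. -/
abbrev piSheaf (n : ℕ) : Sheaf (Type u) X := (piPre P n).sheafify

/-- The presheaf of `C^∞`-rings `U ↦ π_0(P(U))`. -/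
noncomputable abbrev pi0Pre : Presheaf CInfRingCat.{u} X := P ⋙ SCInfRing.pi0

/-- The associated sheaf of `C^∞`-rings of `U ↦ π_0(P(U))`. -/
noncomputable abbrev pi0Sheaf : Presheaf CInfRingCat.{u} X := assocSheaf (pi0Pre P)

/-- Forgetting the `C^∞`-ring structure of `pi0Sheaf` gives back the sheaf of sets `piSheaf 0`. -/
theorem under_pi0Sheaf : under (pi0Sheaf P) = (piSheaf P 0).1 := rfl

variable {P} {n : ℕ}

open SCInfRing

instance (U : Opens X) : AddCommGroup ((piPre P (n + 1)).obj (op U)) :=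
  inferInstanceAs (AddCommGroup (PiSucc (P.obj (op U)) n))

noncomputable instance (U : Opens X) :
    Module ((pi0Pre P).obj (op U)) ((piPre P (n + 1)).obj (op U)) :=
  inferInstanceAs (Module (Pi0 (P.obj (op U))) (PiSucc (P.obj (op U)) n))

def addOp (P : Presheaf SCInfRing.{u} X) (n : ℕ) (U : Opens X)
    (a b : (piPre P (n + 1)).obj (op U)) : (piPre P (n + 1)).obj (op U) := a + b

theorem addOp_natural : IsNatural₂ (addOp P n) := fun _ _ i a b =>
  PiSucc.map_add (P.map i.op) a b

noncomputable def smulOp (P : Presheaf SCInfRing.{u} X) (n : ℕ) (U : Opens X)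
    (a : (under (pi0Pre P)).obj (op U)) (b : (piPre P (n + 1)).obj (op U)) :
    (piPre P (n + 1)).obj (op U) :=
  (show (pi0Pre P).obj (op U) from a) • b

theorem smulOp_natural : IsNatural₂ (smulOp P n) := fun _ _ i a b =>
  PiSucc.map_smul (P.map i.op) a b

def negHom (P : Presheaf SCInfRing.{u} X) (n : ℕ) : piPre P (n + 1) ⟶ piPre P (n + 1) where
  app U := ↾(fun a : PiSucc (P.obj U) n => -a)
  naturality U V i := by
    ext a
    exact (PiSucc.map_neg (P.map i) a).symm

variable {x : X}

noncomputable instance : Add ((piPre P (n + 1)).stalk x) := ⟨stalkMap₂ (addOp P n)⟩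
noncomputable instance : Zero ((piPre P (n + 1)).stalk x) :=
  ⟨(piPre P (n + 1)).germ ⊤ x trivial (0 : PiSucc (P.obj (op ⊤)) n)⟩
noncomputable instance : Neg ((piPre P (n + 1)).stalk x) :=
  ⟨(Presheaf.stalkFunctor (Type u) x).map (negHom P n)⟩
noncomputable instance : SMul ((under (pi0Pre P)).stalk x) ((piPre P (n + 1)).stalk x) :=
  ⟨stalkMap₂ (smulOp P n)⟩

section germ
variable {U : Opens X} (hx : x ∈ U)

theorem germ_add (a b : (piPre P (n + 1)).obj (op U)) :
    (piPre P (n + 1)).germ U x hx (a + b) =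
      (piPre P (n + 1)).germ U x hx a + (piPre P (n + 1)).germ U x hx b :=
  (stalkMap₂_germ addOp_natural hx a b).symm

theorem germ_zero : (piPre P (n + 1)).germ U x hx 0 = 0 := by
  refine Eq.trans ?_ ((piPre P (n + 1)).germ_res_apply (homOfLE le_top) x hx
    (0 : PiSucc (P.obj (op ⊤)) n))
  exact congrArg _ (PiSucc.map_zero (P.map (homOfLE le_top).op)).symm

theorem germ_neg (a : (piPre P (n + 1)).obj (op U)) :
    (piPre P (n + 1)).germ U x hx (-a) = -(piPre P (n + 1)).germ U x hx a :=
  (Presheaf.stalkFunctor_map_germ_apply U x hx (negHom P n) a).symm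

theorem germ_smul (r : (pi0Pre P).obj (op U)) (a : (piPre P (n + 1)).obj (op U)) :
    (piPre P (n + 1)).germ U x hx (r • a) =
      (under (pi0Pre P)).germ U x hx r • (piPre P (n + 1)).germ U x hx a :=
  (stalkMap₂_germ smulOp_natural hx r a).symm

/-- Germs of sections as a morphism of `C^∞`-rings. -/
noncomputable def germHom (Q : Presheaf CInfRingCat.{u} X) :
    CInfHom (Q.obj (op U)) ((under Q).stalk x) :=
  ⟨(under Q).germ U x hx, fun f a => (stalkOp_germ f hx a).symm⟩

theorem germ_ring_add (a b : (pi0Pre P).obj (op U)) : (under (pi0Pre P)).germ U x hx (a + b) =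
    (under (pi0Pre P)).germ U x hx a + (under (pi0Pre P)).germ U x hx b :=
  map_add (germHom hx (pi0Pre P)) a b

theorem germ_ring_mul (a b : (pi0Pre P).obj (op U)) : (under (pi0Pre P)).germ U x hx (a * b) =
    (under (pi0Pre P)).germ U x hx a * (under (pi0Pre P)).germ U x hx b :=
  map_mul (germHom hx (pi0Pre P)) a b

theorem germ_ring_one : (under (pi0Pre P)).germ U x hx (1 : (pi0Pre P).obj (op U)) = 1 :=
  map_one (germHom hx (pi0Pre P))

theorem germ_ring_zero : (under (pi0Pre P)).germ U x hx (0 : (pi0Pre P).obj (op U)) = 0 :=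
  map_zero (germHom hx (pi0Pre P))

end germ

/-- Any three germs (two of elements of the same presheaf) live on a common neighbourhood. -/
theorem exists_common₃ {F G H : Presheaf (Type u) X} (s : F.stalk x) (t : G.stalk x)
    (r : H.stalk x) : ∃ (U : Opens X) (hx : x ∈ U) (a : F.obj (op U)) (b : G.obj (op U))
      (c : H.obj (op U)), F.germ U x hx a = s ∧ G.germ U x hx b = t ∧ H.germ U x hx c = r := by
  obtain ⟨U, hU, a, b, rfl, rfl⟩ := exists_common s t
  obtain ⟨V, hV, c, rfl⟩ := H.exists_germ_eq r
  exact ⟨U ⊓ V, ⟨hU, hV⟩, F.map (homOfLE inf_le_left).op a, G.map (homOfLE inf_le_left).op b,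
    H.map (homOfLE inf_le_right).op c,
    F.germ_res_apply _ _ _ _, G.germ_res_apply _ _ _ _, H.germ_res_apply _ _ _ _⟩

noncomputable instance : AddCommGroup ((piPre P (n + 1)).stalk x) where
  add_assoc s t r := by
    obtain ⟨U, hx, a, b, c, rfl, rfl, rfl⟩ := exists_common₃ s t r
    rw [← germ_add, ← germ_add, ← germ_add, ← germ_add, add_assoc]
  zero_add s := by
    obtain ⟨U, hx, a, rfl⟩ := (piPre P (n + 1)).exists_germ_eq s
    rw [← germ_zero hx, ← germ_add, zero_add]
  add_zero s := by
    obtain ⟨U, hx, a, rfl⟩ := (piPre P (n + 1)).exists_germ_eq s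
    rw [← germ_zero hx, ← germ_add, add_zero]
  add_comm s t := by
    obtain ⟨U, hx, a, b, rfl, rfl⟩ := exists_common s t
    rw [← germ_add, ← germ_add, add_comm a b]
  neg_add_cancel s := by
    obtain ⟨U, hx, a, rfl⟩ := (piPre P (n + 1)).exists_germ_eq s
    rw [← germ_neg, ← germ_add, neg_add_cancel, germ_zero]
  nsmul := nsmulRec
  zsmul := zsmulRec

noncomputable instance : Module ((under (pi0Pre P)).stalk x) ((piPre P (n + 1)).stalk x) where
  one_smul s := by
    obtain ⟨U, hx, a, rfl⟩ := (piPre P (n + 1)).exists_germ_eq s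
    rw [← germ_ring_one hx, ← germ_smul, one_smul]
  mul_smul r t s := by
    obtain ⟨U, hx, a, b, c, rfl, rfl, rfl⟩ := exists_common₃ r t s
    rw [← germ_ring_mul, ← germ_smul, ← germ_smul, ← germ_smul, mul_smul]
  smul_zero r := by
    obtain ⟨U, hx, a, rfl⟩ := (under (pi0Pre P)).exists_germ_eq r
    rw [← germ_zero hx, ← germ_smul, smul_zero]
  smul_add r s t := by
    obtain ⟨U, hx, a, b, c, rfl, rfl, rfl⟩ := exists_common₃ r s t
    rw [← germ_add, ← germ_smul, ← germ_smul, ← germ_smul, ← germ_add, smul_add]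
  add_smul r t s := by
    obtain ⟨U, hx, a, b, c, rfl, rfl, rfl⟩ := exists_common₃ r t s
    rw [← germ_ring_add, ← germ_smul, ← germ_smul, ← germ_smul, ← germ_add, add_smul]
  zero_smul s := by
    obtain ⟨U, hx, a, rfl⟩ := (piPre P (n + 1)).exists_germ_eq s
    rw [← germ_ring_zero hx, ← germ_smul, zero_smul, germ_zero]

variable {U : Opens X}

noncomputable instance : Add (Sec (piPre P (n + 1)) U) := ⟨Sec.map₂ addOp_natural⟩
noncomputable instance : Zero (Sec (piPre P (n + 1)) U) :=
  ⟨Sec.mk (fun _ => 0) fun _ hx => ⟨U, hx, 𝟙 U, 0, fun _ hy => (germ_zero hy).symm⟩⟩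
noncomputable instance : Neg (Sec (piPre P (n + 1)) U) :=
  ⟨fun s => Sec.mk (fun x => -s.1 x) fun x hx => by
    obtain ⟨V, hV, i, g, h⟩ := s.exists_germ x hx
    exact ⟨V, hV, i, -g, fun y hy => by rw [germ_neg, ← h y hy]⟩⟩
noncomputable instance : SMul (Sec (under (pi0Pre P)) U) (Sec (piPre P (n + 1)) U) :=
  ⟨Sec.map₂ smulOp_natural⟩

/-- Sections of the sheaf `π_{n+1}` form a group, with operations computed on germs. -/
noncomputable instance : AddCommGroup (Sec (piPre P (n + 1)) U) where
  add_assoc s t r := Subtype.ext (funext fun x => add_assoc (s.1 x) (t.1 x) (r.1 x))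
  zero_add s := Subtype.ext (funext fun x => zero_add (s.1 x))
  add_zero s := Subtype.ext (funext fun x => add_zero (s.1 x))
  add_comm s t := Subtype.ext (funext fun x => add_comm (s.1 x) (t.1 x))
  neg_add_cancel s := Subtype.ext (funext fun x => neg_add_cancel (s.1 x))
  nsmul := nsmulRec
  zsmul := zsmulRec

theorem sec_add_val (r s : Sec (under (pi0Pre P)) U) (x : U) :
    (r + s).1 x = r.1 x + s.1 x :=
  congrArg (CInfRing.op _) (funext fun i => by fin_cases i <;> rfl)

theorem sec_mul_val (r s : Sec (under (pi0Pre P)) U) (x : U) :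
    (r * s).1 x = r.1 x * s.1 x :=
  congrArg (CInfRing.op _) (funext fun i => by fin_cases i <;> rfl)

theorem sec_one_val (x : U) : (1 : Sec (under (pi0Pre P)) U).1 x = 1 :=
  congrArg (CInfRing.op _) (funext fun i => i.elim0)

theorem sec_zero_val (x : U) : (0 : Sec (under (pi0Pre P)) U).1 x = 0 :=
  congrArg (CInfRing.op _) (funext fun i => i.elim0)

/-- The sheaf `π_{n+1}` is a sheaf of modules over the sheaf `π_0`. -/
noncomputable instance : Module (Sec (under (pi0Pre P)) U) (Sec (piPre P (n + 1)) U) where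
  one_smul s := Subtype.ext (funext fun x => by
    change (1 : Sec (under (pi0Pre P)) U).1 x • s.1 x = s.1 x
    rw [sec_one_val, one_smul])
  mul_smul r t s := Subtype.ext (funext fun x => by
    change (r * t).1 x • s.1 x = r.1 x • t.1 x • s.1 x
    rw [sec_mul_val, mul_smul])
  smul_zero r := Subtype.ext (funext fun x => smul_zero (r.1 x))
  smul_add r s t := Subtype.ext (funext fun x => smul_add (r.1 x) (s.1 x) (t.1 x))
  add_smul r t s := Subtype.ext (funext fun x => by
    change (r + t).1 x • s.1 x = r.1 x • s.1 x + t.1 x • s.1 x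
    rw [sec_add_val, add_smul])
  zero_smul s := Subtype.ext (funext fun x => by
    change (0 : Sec (under (pi0Pre P)) U).1 x • s.1 x = 0
    rw [sec_zero_val, zero_smul])

noncomputable instance (A : SCInfRing.{u}) : Module (pi0.obj A) (PiSucc A n) :=
  inferInstanceAs (Module (Pi0 A) (PiSucc A n))

noncomputable instance :
    Module ((pi0Sheaf P).obj (op U)) (Sec (piPre P (n + 1)) U) :=
  inferInstanceAs (Module (Sec (under (pi0Pre P)) U) (Sec (piPre P (n + 1)) U))

variable (P n)

/-- The canonical morphism `π_0(P(X)) → Γ(X, π_0 P)` of `C^∞`-rings. -/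
noncomputable def pi0Unit : pi0.obj (P.obj (op ⊤)) ⟶ (pi0Sheaf P).obj (op ⊤) :=
  (toAssocSheaf (pi0Pre P)).app (op ⊤)

/-- The canonical map `π_{n+1}(P(X)) → Γ(X, π_{n+1} P)`, which is linear over
`π_0(P(X)) → Γ(X, π_0 P)`. -/
noncomputable def piSuccUnit :
    PiSucc (P.obj (op ⊤)) n →ₛₗ[CInfHom.toRingHom (pi0Unit P)] Sec (piPre P (n + 1)) ⊤ where
  toFun := (piPre P (n + 1)).toSheafify.app (op ⊤)
  map_add' a b := Subtype.ext (funext fun x => germ_add x.2 a b)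
  map_smul' r a := Subtype.ext (funext fun x => germ_smul x.2 r a)

end Modules

end Sheafification

/-! ### Simplicial `C^∞`-spaces -/

open TopCat AlgebraicGeometry

/-- Softness: every section over a closed subset (a family of germs which is locally induced by
sections over open sets) extends to a global section. -/
def IsSoft {X : TopCat.{u}} (F : Presheaf (Type u) X) : Prop :=
  ∀ (K : Set X), IsClosed K → ∀ s : ∀ x : K, F.stalk x.1,
    (∀ x : K, ∃ (U : Opens X) (_ : x.1 ∈ U) (t : F.obj (op U)),
      ∀ (y : X) (hK : y ∈ K) (hU : y ∈ U), s ⟨y, hK⟩ = F.germ U y hU t) →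
    ∃ t : F.obj (op ⊤), ∀ x : K, s x = F.germ ⊤ x.1 trivial t

/-- `(X, Q)` is a `C^∞`-space: `X` is Hausdorff and `Q` is a soft sheaf of finitely generated
`C^∞`-rings, whose stalks are local `C^∞`-rings. -/
structure IsCInfSpace (X : TopCat.{u}) (Q : Presheaf CInfRingCat.{u} X) : Prop where
  hausdorff : T2Space X
  isSheaf : Presheaf.IsSheaf (under Q)
  soft : IsSoft (under Q)
  finGen : ∀ U : Opens X, IsFinGen (Q.obj (op U))
  localStalks : ∀ x : X, IsLocalCInf ((under Q).stalk x)

/-- The presheaf of `C^∞`-rings of `n`-simplices. -/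
abbrev level {X : TopCat.{u}} (P : Presheaf SCInfRing.{u} X) (n : ℕ) : Presheaf CInfRingCat.{u} X :=
  P ⋙ (evaluation _ _).obj (op ⦋n⦌)

/-- `X` is a simplicial `C^∞`-space: its structure presheaf is a sheaf of simplicial
`C^∞`-rings, and `(X, π_0(𝒪))` is a `C^∞`-space. -/
structure IsSCInfSpace (X : PresheafedSpace SCInfRing.{u}) : Prop where
  isSheaf : ∀ n : ℕ, Presheaf.IsSheaf (under (level X.presheaf n))
  isCInfSpace : IsCInfSpace X.carrier (pi0Sheaf X.presheaf)

/-- A simplicial `C^∞`-space is localized if the stalks of `𝒪_0` are local `C^∞`-rings. -/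
def isLocalizedSCInfSpace : ObjectProperty (PresheafedSpace SCInfRing.{u}) := fun X =>
  IsSCInfSpace X ∧ ∀ x : X.carrier, IsLocalCInf ((under (level X.presheaf 0)).stalk x)

/-- The category of localized simplicial `C^∞`-spaces. -/
abbrev LocalizedSCInfSpace : Type (u + 1) :=
  (isLocalizedSCInfSpace.{u}).FullSubcategory

/-- The functor of global sections. -/
def globalSections : LocalizedSCInfSpace.{u}ᵒᵖ ⥤ SCInfRing.{u} :=
  (isLocalizedSCInfSpace.{u}).ι.op ⋙ PresheafedSpace.Γ

section maps

variable {X Y : PresheafedSpace SCInfRing.{u}} (f : X ⟶ Y) (n : ℕ)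

/-- The map induced by `f` on the stalks of the presheaves of homotopy groups. -/
noncomputable def piStalkMap (x : X.carrier) :
    (piPre Y.presheaf n).stalk (f.base x) → (piPre X.presheaf n).stalk x :=
  PresheafedSpace.Hom.stalkMap ((SCInfRing.pi n).mapPresheaf.map f) x

theorem piStalkMap_germ (x : X.carrier) (U : Opens Y.carrier) (hx : f.base x ∈ U)
    (a : (piPre Y.presheaf n).obj (op U)) :
    piStalkMap f n x ((piPre Y.presheaf n).germ U _ hx a) =
      (piPre X.presheaf n).germ ((Opens.map f.base).obj U) x hx
        ((SCInfRing.pi n).map (f.c.app (op U)) a) :=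
  ConcreteCategory.congr_hom
    (PresheafedSpace.stalkMap_germ ((SCInfRing.pi n).mapPresheaf.map f) U x hx) a

/-- The map `Γ(U, π_n(𝒪_Y)) → Γ(f⁻¹ U, π_n(𝒪_X))` induced by `f`. -/
noncomputable def piSheafMap (U : Opens Y.carrier) (s : Sec (piPre Y.presheaf n) U) :
    Sec (piPre X.presheaf n) ((Opens.map f.base).obj U) :=
  Sec.mk (fun x => piStalkMap f n x.1 (s.1 ⟨f.base x.1, x.2⟩)) (fun x hx => by
    obtain ⟨V, hV, i, g, h⟩ := s.exists_germ (f.base x) hx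
    refine ⟨(Opens.map f.base).obj V, hV, (Opens.map f.base).map i,
      (SCInfRing.pi n).map (f.c.app (op V)) g, fun y hy => ?_⟩
    exact (congrArg (piStalkMap f n y) (h (f.base y) hy)).trans (piStalkMap_germ f n y V hy g))

/-- `f` is a local weak equivalence if it induces an isomorphism
`(X, π_0(𝒪_X), π_k(𝒪_X)) → (Y, π_0(𝒪_Y), π_k(𝒪_Y))`, i.e. `f` is a homeomorphism on underlying
spaces and the induced homomorphisms of sheaves of homotopy groups are bijective on sections. -/
def IsLocalWeakEquiv : Prop :=
  IsIso f.base ∧ ∀ (k : ℕ) (U : Opens Y.carrier), Function.Bijective (piSheafMap f k U)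

end maps

end DerivedCInf

/-! The sheaf `𝒪_0` acts on every `𝒪_m` through degeneracies, and the face maps are linear for this
action. Once `𝒪_0` has bump functions, and hence something like partitions of unity, a linear
problem in the `𝒪_m` that is solvable locally is solvable globally. Both halves of the comparison of
`π_k(Γ(X, 𝒪))` with `Γ(X, π_k(𝒪))` are such problems. For injectivity, a global simplex that is
locally a boundary must be shown to be a boundary (`IsLocalBoundary.isBoundary`). For surjectivity,
spheres given on a cover and homotopic locally on overlaps must be replaced by one global sphere
locally homotopic to all of them (`homotopyCondition`).

The hypotheses concern `π_0`, whereas the bump functions are needed in `𝒪_0`; this is where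
localization enters. Finitely many generators of `Γ(X, π_0)` have real values at each point, and by
softness these values give a map `F : X → ℝⁿ` inducing the topology (`isInducing_values`). In
particular `X` is second countable. The generators lift to vertices only locally, say to `e` on a
neighbourhood `W` of `x`. Let `f` be a smooth bump function at `F x`, supported in a closed set
inside an open `O` with `F⁻¹ O = W`, and consider `f(e)`. If `f` vanishes near `F y`, choose `g`
with `f g = 0` and `g (F y) ≠ 0`. The stalk of `𝒪_0` at `y` is local, so the germ of `g(e)` is
invertible and the germ of `f(e)` is zero (`germ_op_eq_zero`). Thus `f(e)` really vanishes off the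
support and extends by zero to a global vertex; the same argument for `f - 1` shows that it equals
`1` near `x` (`hasBumps`).

Globalization (`LinearCondition.exists_global`) uses a countable cover by sets `V_j` on which bump
functions `b_j` equal `1`. The weights `b_j ∏_{i<j} (1 - b_i)` have partial sums `1 - ∏_{i<n} (1 -
b_i)`. On `V_j` all weights after the `j`-th vanish, so the sums stabilize there and glue, without
any locally finite refinement.

For the last assertion, translation by a vertex moves every base point to `0`. There the comparison
isomorphisms on both spaces reduce the claim to the bijectivity of the maps on global sections of
the homotopy sheaves. -/

namespace DerivedCInf

/-! ### Real points of `C^∞`-rings -/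

namespace SmoothFn

variable {n : ℕ}

theorem add_toFun (f g : SmoothFn n) (x : Fin n → ℝ) :
    (f + g).toFun x = f.toFun x + g.toFun x := rfl

theorem mul_toFun (f g : SmoothFn n) (x : Fin n → ℝ) :
    (f * g).toFun x = f.toFun x * g.toFun x := rfl

theorem neg_toFun (f : SmoothFn n) (x : Fin n → ℝ) : (-f).toFun x = -f.toFun x := rfl

theorem sub_toFun (f g : SmoothFn n) (x : Fin n → ℝ) :
    (f - g).toFun x = f.toFun x - g.toFun x := by
  rw [sub_eq_add_neg, add_toFun, neg_toFun, sub_eq_add_neg]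

theorem zero_toFun (x : Fin n → ℝ) : (0 : SmoothFn n).toFun x = 0 := rfl

theorem one_toFun (x : Fin n → ℝ) : (1 : SmoothFn n).toFun x = 1 := rfl

/-- Constant functions, as a ring homomorphism. -/
def constHom (n : ℕ) : ℝ →+* SmoothFn n where
  toFun := const n
  map_zero' := rfl
  map_one' := rfl
  map_add' _ _ := rfl
  map_mul' _ _ := rfl

/-- Evaluation at a point, as a ring homomorphism. -/
def evalHom (x : Fin n → ℝ) : SmoothFn n →+* ℝ where
  toFun f := f.toFun x
  map_zero' := rfl
  map_one' := rfl
  map_add' _ _ := rfl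
  map_mul' _ _ := rfl

theorem isUnit_of_ne_zero {f : SmoothFn n} (h : ∀ x, f.toFun x ≠ 0) : IsUnit f :=
  IsUnit.of_mul_eq_one ⟨fun x => (f.toFun x)⁻¹, f.smooth.inv h⟩
    (ext' fun x => mul_inv_cancel₀ (h x))

/-- Every ring homomorphism `C^∞(ℝⁿ) → ℝ` is the evaluation at a point. -/
theorem ringHom_eq_eval (ψ : SmoothFn n →+* ℝ) (f : SmoothFn n) :
    ψ f = f.toFun fun i => ψ (proj i) := by
  -- The only ring endomorphism of `ℝ` is the identity, so `ψ` is automatically `ℝ`-linear.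
  have hc : ∀ r : ℝ, ψ (const n r) = r := fun r =>
    RingHom.congr_fun (Subsingleton.elim (ψ.comp (constHom n)) (RingHom.id ℝ)) r
  by_contra hne
  let d : SmoothFn n := f - const n (ψ f)
  let e : Fin n → SmoothFn n := fun i => proj i - const n (ψ (proj i))
  -- This sum of squares can vanish at `x` only if `x` is the point with coordinates `ψ (proj i)`
  -- and `f` takes the value `ψ f` there. The assumption `hne` excludes this, so `g` is a unit,
  -- although `ψ` kills it.
  let g : SmoothFn n := d * d + ∑ i, e i * e i
  have hψ : ψ g = 0 := by
    simp only [g, d, e, map_add, map_mul, map_sum, map_sub, hc, sub_self, mul_zero,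
      Finset.sum_const_zero, add_zero]
  have hg : ∀ x, g.toFun x = (f.toFun x - ψ f) * (f.toFun x - ψ f) +
      ∑ i, (x i - ψ (proj i)) * (x i - ψ (proj i)) := fun x => by
    have := map_add (evalHom x) (d * d) (∑ i, e i * e i)
    rw [map_sum] at this
    refine this.trans (congrArg₂ _ ?_ (Finset.sum_congr rfl fun i _ => ?_))
    · change (d * d).toFun x = _
      rw [mul_toFun, sub_toFun]; rfl
    · change (e i * e i).toFun x = _
      rw [mul_toFun, sub_toFun]; rfl
  have hu : IsUnit g := isUnit_of_ne_zero fun x hx => by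
    rw [hg, add_eq_zero_iff_of_nonneg (mul_self_nonneg _)
      (Finset.sum_nonneg fun i _ => mul_self_nonneg _),
      Finset.sum_eq_zero_iff_of_nonneg fun i _ => mul_self_nonneg _] at hx
    refine hne ?_
    have hx2 : x = fun i => ψ (proj i) :=
      funext fun i => sub_eq_zero.1 (mul_self_eq_zero.1 (hx.2 i (Finset.mem_univ i)))
    rw [← hx2]
    exact (sub_eq_zero.1 (mul_self_eq_zero.1 hx.1)).symm
  exact (hu.map ψ).ne_zero hψ

/-- A smooth function whose support is a given open set. -/
theorem exists_support_eq {s : Set (Fin n → ℝ)} (hs : IsOpen s) :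
    ∃ f : SmoothFn n, ∀ x, f.toFun x ≠ 0 ↔ x ∈ s := by
  obtain ⟨f, h, hf, -⟩ := hs.exists_contDiff_support_eq (n := ⊤)
  exact ⟨⟨f, hf⟩, fun x => by rw [← h]; rfl⟩

/-- A bump function around a point of an open set. -/
theorem exists_bump {s : Set (Fin n → ℝ)} (hs : IsOpen s) {x : Fin n → ℝ} (hx : x ∈ s) :
    ∃ (f : SmoothFn n) (t k : Set (Fin n → ℝ)), IsOpen t ∧ IsClosed k ∧ x ∈ t ∧ k ⊆ s ∧
      (∀ y ∈ t, f.toFun y = 1) ∧ ∀ y ∉ k, f.toFun y = 0 := by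
  obtain ⟨r, hr, hrs⟩ := Metric.isOpen_iff.1 hs x hx
  -- The function is `1` on the ball of radius `r / 4` and vanishes off the closed ball of radius `r
  -- / 2`, which still lies in the ball of radius `r` inside `s`.
  let f : ContDiffBump x := ⟨r / 4, r / 2, by positivity, by linarith⟩
  refine ⟨⟨f, f.contDiff⟩, Metric.ball x (r / 4), Metric.closedBall x (r / 2), Metric.isOpen_ball,
    Metric.isClosed_closedBall, Metric.mem_ball_self (by positivity),
    (Metric.closedBall_subset_ball (by linarith)).trans hrs,
    fun y hy => f.one_of_mem_closedBall (Metric.ball_subset_closedBall hy), fun y hy => ?_⟩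
  exact f.zero_of_le_dist (le_of_lt (by simpa using hy))

end SmoothFn

namespace CInfRing

variable {A : Type u} [CInfRing A]

/-- Substitution of a tuple of elements into smooth functions. -/
def subst {n : ℕ} (a : Fin n → A) : CInfHom (SmoothFn n) A :=
  ⟨fun f => op f a, fun f g => op_comp f g a⟩

theorem subst_apply {n : ℕ} (a : Fin n → A) (f : SmoothFn n) : subst a f = op f a := rfl

/-- Ring homomorphisms from a `C^∞`-ring to `ℝ` are compatible with smooth operations. -/
theorem ringHom_op (φ : A →+* ℝ) {n : ℕ} (f : SmoothFn n) (a : Fin n → A) :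
    φ (op f a) = f.toFun fun i => φ (a i) := by
  have := SmoothFn.ringHom_eq_eval (φ.comp (subst a).toRingHom) f
  refine this.trans (congrArg f.toFun (funext fun i => ?_))
  exact congrArg φ (op_proj i a)

theorem ringHom_surjective (φ : A →+* ℝ) : Function.Surjective φ := fun r =>
  ⟨op (SmoothFn.const 0 r) ![], ringHom_op φ _ _⟩

end CInfRing

theorem IsLocalCInf.exists_ringHom {A : Type u} [CInfRing A] (h : IsLocalCInf A) :
    Nonempty (A →+* ℝ) := by
  obtain ⟨m, -, -, ⟨e⟩⟩ := h
  exact ⟨e.toRingHom.comp (Ideal.Quotient.mk m)⟩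

/-- Constants make any ring homomorphism to `ℝ` surjective, so its kernel is maximal and must be the
unique maximal ideal. Invertibility can therefore be tested with an arbitrary `φ`, in particular
with one that factors through another `C^∞`-ring. -/
theorem IsLocalCInf.isUnit_iff {A : Type u} [CInfRing A] (h : IsLocalCInf A) (φ : A →+* ℝ)
    (a : A) : IsUnit a ↔ φ a ≠ 0 := by
  refine ⟨fun ha => (ha.map φ).ne_zero, fun ha => ?_⟩
  obtain ⟨m, -, hm, -⟩ := h
  by_contra hu
  obtain ⟨m', hm', ham'⟩ := exists_max_ideal_of_mem_nonunits hu
  have := RingHom.ker_isMaximal_of_surjective φ (CInfRing.ringHom_surjective φ)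
  rw [hm _ hm', ← hm _ this] at ham'
  exact ha ham'

/-! ### Sections of a sheaf of simplicial `C^∞`-rings -/

section Sections

open TopCat SCInfRing

variable {X : TopCat.{u}} (P : Presheaf SCInfRing.{u} X)

/-- Sections over `U` of the presheaf of `m`-simplices. -/
abbrev Sect (m : ℕ) (U : Opens X) : Type u := (P.obj (op U)) _⦋m⦌

variable {P}

/-- Restriction of `m`-simplices. -/
def res {m : ℕ} {U V : Opens X} (h : V ≤ U) : CInfHom (Sect P m U) (Sect P m V) :=
  (P.map (homOfLE h).op).app (op ⦋m⦌)

theorem res_res {m : ℕ} {U V W : Opens X} (h : V ≤ U) (h' : W ≤ V) (t : Sect P m U) :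
    res h' (res h t) = res (h'.trans h) t := by
  have : P.map (homOfLE (h'.trans h)).op = P.map (homOfLE h).op ≫ P.map (homOfLE h').op := by
    rw [← P.map_comp]; rfl
  have := congrArg (fun f => f.app (op ⦋m⦌)) this
  exact (ConcreteCategory.congr_hom this t).symm

theorem res_refl {m : ℕ} {U : Opens X} (t : Sect P m U) : res le_rfl t = t := by
  have : P.map (homOfLE (le_refl U)).op = 𝟙 _ := P.map_id _
  have := congrArg (fun f => f.app (op ⦋m⦌)) this
  exact ConcreteCategory.congr_hom this t

theorem δ_res {m : ℕ} {U V : Opens X} (h : V ≤ U) (i : Fin (m + 2)) (t : Sect P (m + 1) U) :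
    (P.obj (op V)).δ i (res h t) = res h ((P.obj (op U)).δ i t) :=
  (δ_hom (P.map (homOfLE h).op) i t).symm

theorem cst_res {m : ℕ} {U V : Opens X} (h : V ≤ U) (c : Sect P 0 U) :
    res h (cst c m) = cst (res h c) m :=
  cst_hom (P.map (homOfLE h).op) c m

theorem res_zero {m : ℕ} {U V : Opens X} (h : V ≤ U) : res h (0 : Sect P m U) = 0 :=
  map_zero (res h)

theorem res_one {m : ℕ} {U V : Opens X} (h : V ≤ U) : res h (1 : Sect P m U) = 1 :=
  map_one (res h)

theorem res_add {m : ℕ} {U V : Opens X} (h : V ≤ U) (s t : Sect P m U) :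
    res h (s + t) = res h s + res h t :=
  map_add (res h) s t

theorem res_sub {m : ℕ} {U V : Opens X} (h : V ≤ U) (s t : Sect P m U) :
    res h (s - t) = res h s - res h t :=
  map_sub (res h) s t

theorem res_mul {m : ℕ} {U V : Opens X} (h : V ≤ U) (s t : Sect P m U) :
    res h (s * t) = res h s * res h t :=
  map_mul (res h) s t

variable (P) in
/-- The germ of an `m`-simplex. -/
noncomputable def germ (m : ℕ) {U : Opens X} {x : X} (hx : x ∈ U) :
    CInfHom (Sect P m U) ((under (level P m)).stalk x) :=
  germHom hx (level P m)

theorem germ_res {m : ℕ} {U V : Opens X} (h : V ≤ U) {x : X} (hx : x ∈ V) (t : Sect P m U) :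
    germ P m hx (res h t) = germ P m (h hx) t :=
  (under (level P m)).germ_res_apply (homOfLE h) x hx t

theorem exists_res_eq_of_germ_eq {m : ℕ} {U : Opens X} {x : X} (hx : x ∈ U) {s t : Sect P m U}
    (h : germ P m hx s = germ P m hx t) :
    ∃ (V : Opens X) (_ : x ∈ V) (hV : V ≤ U), res hV s = res hV t := by
  obtain ⟨W, hW, i, j, e⟩ := (under (level P m)).germ_eq x hx hx s t h
  exact ⟨W, hW, i.le, e⟩

variable (hP : ∀ n : ℕ, Presheaf.IsSheaf (under (level P n)))
include hP

theorem eq_of_locally {m : ℕ} {U : Opens X} {s t : Sect P m U}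
    (h : ∀ x ∈ U, ∃ (V : Opens X) (_ : x ∈ V) (hV : V ≤ U), res hV s = res hV t) : s = t := by
  choose V hx hV e using h
  refine TopCat.Sheaf.eq_of_locally_eq' ⟨_, hP m⟩ (fun x : U => V x.1 x.2) U
    (fun x => homOfLE (hV x.1 x.2)) (fun x hxU => Opens.mem_iSup.2 ⟨⟨x, hxU⟩, hx x hxU⟩) s t
    (fun x => e x.1 x.2)

theorem eq_of_germ {m : ℕ} {U : Opens X} {s t : Sect P m U}
    (h : ∀ (x : X) (hx : x ∈ U), germ P m hx s = germ P m hx t) : s = t :=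
  eq_of_locally hP fun x hx => exists_res_eq_of_germ_eq hx (h x hx)

theorem exists_glue {m : ℕ} {ι : Type*} {U : Opens X} (V : ι → Opens X) (hV : ∀ i, V i ≤ U)
    (hc : ∀ x ∈ U, ∃ i, x ∈ V i) (s : ∀ i, Sect P m (V i))
    (h : ∀ i j, res (inf_le_left : V i ⊓ V j ≤ V i) (s i) = res inf_le_right (s j)) :
    ∃ t : Sect P m U, ∀ i, res (hV i) t = s i := by
  have hs : Presheaf.IsCompatible (under (level P m)) V s := h
  obtain ⟨t, ht, -⟩ := TopCat.Sheaf.existsUnique_gluing' ⟨_, hP m⟩ V U (fun i => homOfLE (hV i))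
    (fun x hxU => Opens.mem_iSup.2 (hc x hxU)) _ hs
  exact ⟨t, ht⟩

/-- Extension by zero. -/
theorem exists_extend_zero {m : ℕ} {U Z : Opens X} (hc : ∀ x, x ∈ U ∨ x ∈ Z) (s : Sect P m U)
    (h : res (inf_le_left : U ⊓ Z ≤ U) s = 0) :
    ∃ t : Sect P m ⊤, res le_top t = s ∧ res (le_top : Z ≤ ⊤) t = 0 := by
  -- Glue `s` on `U` with `0` on `Z`; the hypothesis `h` is the compatibility on the overlap.
  obtain ⟨t, ht⟩ := exists_glue hP (U := ⊤) (fun b : Bool => cond b U Z)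
    (fun _ => le_top)
    (fun x _ => (hc x).elim (fun h => ⟨true, h⟩) fun h => ⟨false, h⟩)
    (fun b => match b with
      | true => s
      | false => 0) (by
      rintro (_ | _) (_ | _)
      · rfl
      · refine (res_zero _).trans ?_
        have h' := congrArg (res (le_of_eq (inf_comm _ _) : Z ⊓ U ≤ U ⊓ Z)) h
        rw [res_res, res_zero] at h'
        exact h'.symm
      · exact h.trans (res_zero _).symm
      · rfl)
  exact ⟨t, ht true, ht false⟩

omit hP

theorem cst_mul' {A : SCInfRing.{u}} (a b : A _⦋0⦌) (m : ℕ) :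
    cst (a * b) m = cst a m * cst b m := by
  unfold cst; rw [map_mul]

theorem cst_one' {A : SCInfRing.{u}} (m : ℕ) : cst (1 : A _⦋0⦌) m = 1 := by
  unfold cst; rw [map_one]

end Sections

/-! ### The topology of `C^∞`-spaces -/

section Topology

open TopCat SCInfRing

variable {X : TopCat.{u}}

theorem germHom_res {Q : Presheaf CInfRingCat.{u} X} {U V : Opens X} (i : V ⟶ U) {x : X}
    (hx : x ∈ V) (s : Q.obj (op U)) :
    germHom hx Q (Q.map i.op s) = germHom (i.le hx) Q s :=
  (under Q).germ_res_apply i x hx s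

theorem exists_map_eq_of_germHom_eq {Q : Presheaf CInfRingCat.{u} X} {U : Opens X} {x : X}
    (hx : x ∈ U) {s t : Q.obj (op U)} (h : germHom hx Q s = germHom hx Q t) :
    ∃ (V : Opens X) (_ : x ∈ V) (i : V ⟶ U), Q.map i.op s = Q.map i.op t := by
  obtain ⟨W, hW, i, j, e⟩ := (under Q).germ_eq x hx hx s t h
  exact ⟨W, hW, i, Subsingleton.elim j i ▸ e⟩

/-- Germs of global sections. -/
noncomputable abbrev topGerm (Q : Presheaf CInfRingCat.{u} X) (x : X) :
    CInfHom (Q.obj (op ⊤)) ((under Q).stalk x) :=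
  germHom (Opens.mem_top x) Q

/-- The points at which a section with local stalks is invertible form an open set. -/
theorem isOpen_isUnit_germ {Q : Presheaf CInfRingCat.{u} X} (s : Q.obj (op ⊤)) :
    IsOpen {x | IsUnit (topGerm Q x s)} := by
  refine isOpen_iff_forall_mem_open.2 fun x hx => ?_
  obtain ⟨b, hb⟩ := hx.exists_right_inv
  obtain ⟨U, hU, t, rfl⟩ := (under Q).exists_germ_eq b
  have h : germHom hU Q (Q.map (homOfLE (le_top : U ≤ ⊤)).op s * t) = germHom hU Q 1 := by
    rw [map_mul, germHom_res, map_one]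
    exact hb
  obtain ⟨V, hV, i, e⟩ := exists_map_eq_of_germHom_eq hU h
  refine ⟨V, fun y hy => ?_, V.2, hV⟩
  have := congrArg (germHom hy Q) e
  rw [germHom_res, germHom_res, map_mul, germHom_res, map_one] at this
  exact IsUnit.of_mul_eq_one _ this

namespace IsCInfSpace

variable {Q : Presheaf CInfRingCat.{u} X} (h : IsCInfSpace X Q)
  (φ : ∀ x : X, (under Q).stalk x →+* ℝ)
include h

theorem germ_ne_zero_iff_isUnit (x : X) (a : (under Q).stalk x) : IsUnit a ↔ φ x a ≠ 0 :=
  (h.localStalks x).isUnit_iff (φ x) a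

/-- Softness separates points from closed sets. -/
theorem exists_separating {x : X} {U : Opens X} (hx : x ∈ U) :
    ∃ t : Q.obj (op ⊤), topGerm Q x t = 1 ∧
      ∀ y ∉ U, topGerm Q y t = 0 := by
  classical
  have := h.hausdorff
  -- Prescribe the germ `1` at `x` and `0` on the complement of `U`. This is a section over a closed
  -- set: `U` meets that set only in `x`, and the complement of `{x}` is open because `X` is
  -- Hausdorff.
  obtain ⟨t, ht⟩ := h.soft ({x} ∪ (U : Set X)ᶜ)
    (isClosed_singleton.union U.2.isClosed_compl) (fun y => if y.1 = x then 1 else 0) (by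
      rintro ⟨y, rfl | hy⟩
      · refine ⟨U, hx, (1 : Q.obj (op U)), fun z hz hzU => ?_⟩
        obtain rfl : z = y := hz.resolve_right fun h => h hzU
        rw [if_pos rfl]
        exact (map_one (germHom hzU Q)).symm
      · refine ⟨⟨{x}ᶜ, isClosed_singleton.isOpen_compl⟩, fun e : y = x => hy (e ▸ hx),
          (0 : Q.obj (op _)), fun z hz hzU => ?_⟩
        refine (if_neg fun e : z = x => hzU e).trans ?_
        exact (map_zero (germHom hzU Q)).symm)
  refine ⟨t, ?_, fun y hy => ?_⟩
  · exact (ht ⟨x, Or.inl rfl⟩).symm.trans (if_pos rfl)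
  · exact (ht ⟨y, Or.inr hy⟩).symm.trans (if_neg fun e : y = x => hy (e ▸ hx))

/-- The values of generators of the ring of global sections embed the space into `ℝⁿ`. -/
theorem isInducing_values {n : ℕ} (ψ : CInfHom (SmoothFn n) (Q.obj (op ⊤)))
    (hψ : Function.Surjective ψ) :
    Topology.IsInducing fun (x : X) (i : Fin n) =>
      φ x (topGerm Q x (ψ (SmoothFn.proj i))) := by
  set F : X → Fin n → ℝ := fun x i => φ x (topGerm Q x (ψ (SmoothFn.proj i)))
  have hF : ∀ (f : SmoothFn n) (x : X),
      φ x (topGerm Q x (ψ f)) = f.toFun (F x) := fun f x =>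
    SmoothFn.ringHom_eq_eval
      ((φ x).comp ((topGerm Q x).toRingHom.comp ψ.toRingHom)) f
  have hO : ∀ O : Set (Fin n → ℝ), IsOpen O → IsOpen (F ⁻¹' O) := fun O hO => by
    -- With `O` written as the nonvanishing locus of `f`, its preimage is the locus where `ψ f` is
    -- invertible. This gives continuity of `F`.
    obtain ⟨f, hf⟩ := SmoothFn.exists_support_eq hO
    convert isOpen_isUnit_germ (ψ f) using 1
    ext x
    exact ((h.germ_ne_zero_iff_isUnit φ x _).trans (by rw [hF, hf]; rfl)).symm
  refine ⟨le_antisymm (continuous_iff_le_induced.1 ⟨hO⟩) fun U hU => ?_⟩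
  refine (@isOpen_iff_forall_mem_open _ (.induced F inferInstance) U).2 fun x hx => ?_
  -- Conversely, a separating section is some `ψ f`, and the preimage of the nonvanishing locus of
  -- `f` is a neighbourhood of `x` contained in `U`.
  obtain ⟨t, ht1, ht0⟩ := h.exists_separating (U := ⟨U, hU⟩) hx
  obtain ⟨f, rfl⟩ := hψ t
  refine ⟨F ⁻¹' {y | f.toFun y ≠ 0}, fun y hy => ?_, ?_, ?_⟩
  · by_contra hyU
    refine hy ?_
    rw [← hF, ht0 y hyU, map_zero]
  · exact isOpen_induced (isOpen_ne_fun f.smooth.continuous continuous_const)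
  · change f.toFun (F x) ≠ 0
    rw [← hF, ht1, map_one]
    exact one_ne_zero

/-- The topology is induced from `ℝⁿ`. This supplies the countable subcovers needed for
globalization. -/
theorem secondCountableTopology : SecondCountableTopology X := by
  obtain ⟨n, ψ, hψ⟩ := h.finGen ⊤
  have φ : ∀ x : X, (under Q).stalk x →+* ℝ := fun x => (h.localStalks x).exists_ringHom.some
  exact (h.isInducing_values φ ψ hψ).secondCountableTopology

end IsCInfSpace

/-- The morphism induced on stalks by a morphism of presheaves of `C^∞`-rings. -/
noncomputable def stalkHom {Q Q' : Presheaf CInfRingCat.{u} X} (η : Q ⟶ Q') (x : X) :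
    CInfHom ((under Q).stalk x) ((under Q').stalk x) where
  toFun := (Presheaf.stalkFunctor (Type u) x).map (Functor.whiskerRight η (forget _))
  map_op' f t := by
    obtain ⟨U, hx, a, ha⟩ := exists_common_fin t
    obtain rfl := funext ha
    refine (congrArg _ (stalkOp_germ f hx a)).trans ?_
    simp only [Presheaf.stalkFunctor_map_germ_apply]
    refine Eq.trans ?_ (stalkOp_germ f hx fun i => η.app (op U) (a i)).symm
    exact congrArg _ (CInfHom.map_op (η.app (op U)) f a)

theorem stalkHom_germHom {Q Q' : Presheaf CInfRingCat.{u} X} (η : Q ⟶ Q') {x : X} {U : Opens X}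
    (hx : x ∈ U) (s : Q.obj (op U)) :
    stalkHom η x (germHom hx Q s) = germHom hx Q' (η.app (op U) s) :=
  Presheaf.stalkFunctor_map_germ_apply U x hx (Functor.whiskerRight η (forget _)) s

/-- The class of a vertex in `π_0`. -/
noncomputable def vertexClass (P : Presheaf SCInfRing.{u} X) : level P 0 ⟶ pi0Pre P where
  app U := Pi0.mkHom (P.obj U)
  naturality _ _ _ := rfl

end Topology

/-! ### Bump functions of degree zero -/

section Bump

open TopCat SCInfRing

variable {X : TopCat.{u}} {P : Presheaf SCInfRing.{u} X}

variable (P) in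
/-- The class of a vertex in the sheaf `π_0`. -/
noncomputable def vertexClassSheaf : level P 0 ⟶ pi0Sheaf P :=
  vertexClass P ≫ toAssocSheaf (pi0Pre P)

/-- Global sections of the sheaf `π_0` lift locally to vertices. -/
theorem exists_local_lift {n : ℕ} (s : Fin n → (pi0Sheaf P).obj (op ⊤)) {x : X} {U : Opens X}
    (hx : x ∈ U) : ∃ (V : Opens X) (_ : V ≤ U) (_ : x ∈ V) (e : Fin n → Sect P 0 V),
      ∀ (y : X) (hy : y ∈ V) (i : Fin n),
        stalkHom (vertexClassSheaf P) y (germ P 0 hy (e i)) = topGerm (pi0Sheaf P) y (s i) := by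
  choose V hxV j g hg using fun i => Sec.exists_germ (s i) x trivial
  choose e he using fun i => Pi0.mk_surjective (A := P.obj (op (V i))) (g i)
  let W : Opens X := ⟨(⋂ i, (V i : Set X)) ∩ U,
    (isOpen_iInter_of_finite fun i => (V i).2).inter U.2⟩
  have hW : ∀ i, W ≤ V i := fun i y hy => Set.mem_iInter.1 hy.1 i
  refine ⟨W, fun y hy => hy.2, ⟨Set.mem_iInter.2 hxV, hx⟩, fun i => res (hW i) (e i),
    fun y hy i => ?_⟩
  rw [germ_res]
  refine (stalkHom_germHom (vertexClassSheaf P) (hW i hy) (e i)).trans ?_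
  have : (vertexClassSheaf P).app (op (V i)) (e i) =
      (pi0Sheaf P).map (homOfLE (le_top : V i ≤ ⊤)).op (s i) := by
    refine Subtype.ext (funext fun z => ?_)
    refine Eq.trans ?_ (hg i z.1 z.2).symm
    exact congrArg ((under (pi0Pre P)).germ (V i) z.1 z.2) (he i)
  rw [this]
  exact germHom_res (homOfLE (le_top : V i ≤ ⊤)) (hW i hy) (s i)

/-- A smooth function which vanishes near the values of `e` at `y` has a vanishing germ. -/
theorem germ_op_eq_zero (hL : ∀ x : X, IsLocalCInf ((under (level P 0)).stalk x)) {n : ℕ}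
    {V : Opens X} (e : Fin n → Sect P 0 V) {y : X} (hy : y ∈ V)
    (φ : (under (level P 0)).stalk y →+* ℝ) (f : SmoothFn n) {O : Set (Fin n → ℝ)} (hO : IsOpen O)
    (hyO : (fun i => φ (germ P 0 hy (e i))) ∈ O) (hf : ∀ z ∈ O, f.toFun z = 0) :
    germ P 0 hy (CInfRing.op f e) = 0 := by
  -- Since `f` vanishes on `O` and `g` vanishes off it, `f * g = 0`, while `g` takes an invertible
  -- germ at `y`.
  obtain ⟨g, hg⟩ := SmoothFn.exists_support_eq hO
  have hfg : f * g = 0 := SmoothFn.ext' fun z => by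
    rw [SmoothFn.mul_toFun, SmoothFn.zero_toFun]
    by_cases hz : z ∈ O
    · rw [hf z hz, zero_mul]
    · rw [not_not.1 (mt (hg z).1 hz), mul_zero]
  have hu : IsUnit (germ P 0 hy (CInfRing.op g e)) := by
    rw [(hL y).isUnit_iff φ, CInfHom.map_op, CInfRing.ringHom_op]
    exact (hg _).2 hyO
  refine (hu.mul_left_eq_zero).1 ?_
  rw [← map_mul, ← CInfRing.subst_apply, ← CInfRing.subst_apply, ← map_mul, hfg, map_zero, map_zero]

variable (P) in
/-- Points have bump functions in the ring of global vertices. -/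
def HasBumps : Prop :=
  ∀ ⦃x : X⦄ ⦃U : Opens X⦄, x ∈ U →
    ∃ (b : Sect P 0 ⊤) (V Z : Opens X), x ∈ V ∧ (∀ y, y ∈ U ∨ y ∈ Z) ∧
      res (le_top : V ≤ ⊤) b = 1 ∧ res (le_top : Z ≤ ⊤) b = 0

/-- A bump function on `ℝⁿ` is substituted into local lifts of generators of `Γ(X, π_0)`. Locality
of the stalks of `𝒪_0` turns vanishing of the function near a value into vanishing of the germ, so
the local vertex extends by zero. -/
theorem hasBumps (hP : ∀ n : ℕ, Presheaf.IsSheaf (under (level P n)))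
    (hQ : IsCInfSpace X (pi0Sheaf P))
    (hL : ∀ x : X, IsLocalCInf ((under (level P 0)).stalk x)) : HasBumps P := by
  intro x U hx
  obtain ⟨n, ψ, hψ⟩ := hQ.finGen ⊤
  have φ : ∀ x : X, (under (pi0Sheaf P)).stalk x →+* ℝ := fun x =>
    (hQ.localStalks x).exists_ringHom.some
  have hF := hQ.isInducing_values φ ψ hψ
  set F : X → Fin n → ℝ := fun x i => φ x (topGerm (pi0Sheaf P) x (ψ (SmoothFn.proj i)))
  obtain ⟨W, hWU, hxW, e, he⟩ := exists_local_lift (fun i => ψ (SmoothFn.proj i)) hx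
  obtain ⟨O, hO, hOW⟩ := hF.isOpen_iff.1 W.2
  have hxO : F x ∈ O := (Set.ext_iff.1 hOW x).2 hxW
  obtain ⟨f, t, k, ht, hk, hxt, hkO, hf1, hf0⟩ := SmoothFn.exists_bump hO hxO
  have hkW : ∀ y, F y ∈ k → y ∈ W := fun y hy => (Set.ext_iff.1 hOW y).1 (hkO hy)
  let Z : Opens X := ⟨F ⁻¹' kᶜ, hk.isOpen_compl.preimage hF.continuous⟩
  let V : Opens X := ⟨F ⁻¹' t ∩ W, (ht.preimage hF.continuous).inter W.2⟩
  have hVW : V ≤ W := fun y hy => hy.2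
  have hWZ : ∀ y, y ∈ W ∨ y ∈ Z := fun y => (em (F y ∈ k)).imp (hkW y) fun h => h
  -- The real point `φ y` of the stalk of `π_0` is pulled back to the stalk of `𝒪_0`; there the
  -- lifts `e i` take the same values as the generators they lift.
  have hval : ∀ (y : X) (hy : y ∈ W), (fun i => ((φ y).comp
      (stalkHom (vertexClassSheaf P) y).toRingHom) (germ P 0 hy (e i))) = F y := fun y hy =>
    funext fun i => congrArg (φ y) (he y hy i)
  have hZ : res (inf_le_left : W ⊓ Z ≤ W) (CInfRing.op f e) = 0 := eq_of_germ hP fun y hy => by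
    rw [germ_res, map_zero]
    refine germ_op_eq_zero hL e hy.1
      ((φ y).comp (stalkHom (vertexClassSheaf P) y).toRingHom) f hk.isOpen_compl ?_ hf0
    rw [hval]
    exact hy.2
  -- The vanishing criterion is applied to `f - 1`, which is zero on `t`.
  have hV : res hVW (CInfRing.op f e) = 1 := eq_of_germ hP fun y hy => by
    rw [germ_res, map_one, ← sub_eq_zero, ← map_one (germ P 0 (hVW hy)), ← map_sub,
      ← map_one (CInfRing.subst e), ← CInfRing.subst_apply, ← map_sub]
    refine germ_op_eq_zero hL e hy.2
      ((φ y).comp (stalkHom (vertexClassSheaf P) y).toRingHom) (f - 1) ht ?_ fun z hz => ?_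
    · rw [hval]
      exact hy.1
    · rw [SmoothFn.sub_toFun, hf1 z hz, SmoothFn.one_toFun, sub_self]
  obtain ⟨b, hb, hbZ⟩ := exists_extend_zero hP hWZ _ hZ
  refine ⟨b, V, Z, ⟨hxt, hxW⟩, fun y => (hWZ y).imp_left fun h => hWU h, ?_, hbZ⟩
  rw [← res_res le_top hVW, hb, hV]

end Bump

/-! ### Gluing with partitions of unity -/

section Gluing

open TopCat SCInfRing

variable {X : TopCat.{u}}

/-- A subsheaf of modules of `𝒪_0 × 𝒪_m`. A pair `(p, t)` belonging to it is to be thought of as a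
solution `t` of a linear problem multiplied by `p`. -/
structure LinearCondition (P : Presheaf SCInfRing.{u} X) (m : ℕ) where
  holds : ∀ U : Opens X, Sect P 0 U → Sect P m U → Prop
  zero : ∀ U, holds U 0 0
  add : ∀ {U} {p q : Sect P 0 U} {s t : Sect P m U},
    holds U p s → holds U q t → holds U (p + q) (s + t)
  smul : ∀ {U} (c : Sect P 0 U) {p : Sect P 0 U} {t : Sect P m U},
    holds U p t → holds U (c * p) (cst c m * t)
  restrict : ∀ {U V} (h : V ≤ U) {p : Sect P 0 U} {t : Sect P m U},
    holds U p t → holds V (res h p) (res h t)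
  isLocal : ∀ {U} {p : Sect P 0 U} {t : Sect P m U},
    (∀ x ∈ U, ∃ (V : Opens X) (_ : x ∈ V) (h : V ≤ U), holds V (res h p) (res h t)) → holds U p t

variable {P : Presheaf SCInfRing.{u} X}

/-- Local solutions of a linear problem, multiplied by a bump function, extend globally. -/
theorem LinearCondition.exists_extend {m : ℕ} (C : LinearCondition P m)
    (hP : ∀ n : ℕ, Presheaf.IsSheaf (under (level P n))) {U Z : Opens X}
    (hc : ∀ x, x ∈ U ∨ x ∈ Z) (b : Sect P 0 ⊤) (hb : res (le_top : Z ≤ ⊤) b = 0)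
    {t : Sect P m U} (ht : C.holds U 1 t) : ∃ T : Sect P m ⊤, C.holds ⊤ b T := by
  -- The product of `b` and `t` vanishes on `U ⊓ Z` because `b` vanishes on `Z`.
  obtain ⟨T, hT, hTZ⟩ := exists_extend_zero hP hc (cst (res le_top b) m * t) (by
    rw [res_mul, cst_res, res_res, ← res_res (le_top : Z ≤ ⊤) (inf_le_right : U ⊓ Z ≤ Z), hb,
      res_zero, cst_zero, zero_mul])
  refine ⟨T, C.isLocal fun x _ => (hc x).elim (fun h => ⟨U, h, le_top, ?_⟩)
    fun h => ⟨Z, h, le_top, ?_⟩⟩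
  · rw [hT]
    simpa using C.smul (res le_top b) ht
  · rw [hb, hTZ]
    exact C.zero Z

/-- Linear problems over a sheaf with bump functions which are locally solvable are globally
solvable. -/
theorem LinearCondition.exists_global [SecondCountableTopology X] {m : ℕ} (C : LinearCondition P m)
    (hP : ∀ n : ℕ, Presheaf.IsSheaf (under (level P n)))
    (hbump : HasBumps P)
    (hex : ∀ x : X, ∃ (U : Opens X) (_ : x ∈ U) (t : Sect P m U), C.holds U 1 t) :
    ∃ t : Sect P m ⊤, C.holds ⊤ 1 t := by
  -- The enumeration of the cover by `ℕ` below needs a nonempty index set.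
  rcases isEmpty_or_nonempty X with hX | hX
  · exact ⟨0, C.isLocal fun x => hX.elim x⟩
  have key : ∀ x : X, ∃ (b : Sect P 0 ⊤) (T : Sect P m ⊤) (V : Opens X), x ∈ V ∧
      res (le_top : V ≤ ⊤) b = 1 ∧ C.holds ⊤ b T := fun x => by
    obtain ⟨U, hxU, t, ht⟩ := hex x
    obtain ⟨b, V, Z, hxV, hc, hbV, hbZ⟩ := hbump hxU
    obtain ⟨T, hT⟩ := C.exists_extend hP hc b hbZ ht
    exact ⟨b, T, V, hxV, hbV, hT⟩
  choose b T V hxV hbV hT using key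
  obtain ⟨s, hs, hsV⟩ := TopologicalSpace.countable_cover_nhds fun x => (V x).2.mem_nhds (hxV x)
  have hsn : s.Nonempty := by
    obtain ⟨x⟩ := hX
    obtain ⟨y, hy, -⟩ := Set.mem_iUnion₂.1 (hsV ▸ Set.mem_univ x)
    exact ⟨y, hy⟩
  obtain ⟨a, rfl⟩ := hs.exists_eq_range hsn
  have hcov : ∀ x : X, ∃ j, x ∈ V (a j) := fun x => by
    obtain ⟨y, ⟨j, rfl⟩, hy⟩ := Set.mem_iUnion₂.1 (hsV ▸ Set.mem_univ x)
    exact ⟨j, hy⟩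
  -- The weights `q n * b (a n)` telescope to `1 - q n`. Hence `S n` solves the problem with weight
  -- `1 - q n`, which is `1` on `V (a j)` as soon as `j < n`.
  let q : ℕ → Sect P 0 ⊤ := fun n => ∏ i ∈ Finset.range n, (1 - b (a i))
  let S : ℕ → Sect P m ⊤ := fun n => ∑ i ∈ Finset.range n, cst (q i) m * T (a i)
  have hq : ∀ j n, j < n → res (le_top : V (a j) ≤ ⊤) (q n) = 0 := fun j n hjn => by
    refine (map_prod (res (le_top : V (a j) ≤ ⊤)) _ _).trans
      (Finset.prod_eq_zero (Finset.mem_range.2 hjn) ?_)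
    rw [res_sub, hbV, res_one, sub_self]
  have hS : ∀ n, C.holds ⊤ (1 - q n) (S n) := fun n => by
    induction n with
    | zero => simpa [q, S] using C.zero ⊤
    | succ n ih =>
      have e1 : 1 - q (n + 1) = (1 - q n) + q n * b (a n) := by
        simp only [q, Finset.prod_range_succ]; ring
      have e2 : S (n + 1) = S n + cst (q n) m * T (a n) := Finset.sum_range_succ _ _
      rw [e1, e2]
      exact C.add ih (C.smul _ (hT _))
  -- On `V (a j)` the factor `1 - b (a j)` kills every summand after the `j`-th, so the sums are
  -- constant there from index `j + 1` on.
  have hSV : ∀ j n, j + 1 ≤ n →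
      res (le_top : V (a j) ≤ ⊤) (S n) = res le_top (S (j + 1)) := fun j n hjn => by
    induction n, hjn using Nat.le_induction with
    | base => rfl
    | succ n hn ih =>
      have e2 : S (n + 1) = S n + cst (q n) m * T (a n) := Finset.sum_range_succ _ _
      rw [e2, res_add, ih, res_mul, cst_res, hq j n hn, cst_zero, zero_mul, add_zero]
  have hcompat : ∀ i j, i ≤ j → ∀ (W : Opens X) (hi : W ≤ V (a i)) (hj : W ≤ V (a j)),
      res hi (res (le_top : V (a i) ≤ ⊤) (S (i + 1))) =
        res hj (res (le_top : V (a j) ≤ ⊤) (S (j + 1))) := fun i j hij W hi hj => by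
    rw [← hSV i (j + 1) (by omega), res_res, res_res]
  obtain ⟨t, ht⟩ := exists_glue hP (U := ⊤) (fun j => V (a j)) (fun _ => le_top)
    (fun x _ => hcov x) (fun j => res le_top (S (j + 1))) fun i j => by
      rcases le_total i j with h | h
      · exact hcompat i j h _ _ _
      · exact (hcompat j i h _ _ _).symm
  refine ⟨t, C.isLocal fun x _ => ?_⟩
  obtain ⟨j, hj⟩ := hcov x
  refine ⟨V (a j), hj, le_top, ?_⟩
  have := C.restrict (le_top : V (a j) ≤ ⊤) (hS (j + 1))
  rw [res_sub, hq j _ (Nat.lt_succ_self j), sub_zero] at this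
  rw [ht j]
  exact this

end Gluing

/-! ### Homotopy classes and boundaries -/

namespace SCInfRing

variable {A B : SCInfRing.{u}} {k : ℕ}

/-- `x` is the last but one face of a simplex whose other faces vanish. -/
def IsBoundary (x : A _⦋k⦌) : Prop :=
  ∃ z : A _⦋k + 1⦌, A.δ (Fin.last k).castSucc z = x ∧ A.δ (Fin.last (k + 1)) z = 0 ∧
    ∀ i : Fin (k + 2), i < (Fin.last k).castSucc → A.δ i z = 0

theorem IsBoundary.zero : IsBoundary (0 : A _⦋k⦌) :=
  ⟨0, map_zero _, map_zero _, fun _ _ => map_zero _⟩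

theorem IsBoundary.add {x y : A _⦋k⦌} (hx : IsBoundary x) (hy : IsBoundary y) :
    IsBoundary (x + y) := by
  obtain ⟨z, h1, h2, h3⟩ := hx
  obtain ⟨w, h1', h2', h3'⟩ := hy
  exact ⟨z + w, by rw [map_add, h1, h1'], by rw [map_add, h2, h2', add_zero],
    fun i hi => by rw [map_add, h3 i hi, h3' i hi, add_zero]⟩

theorem IsBoundary.neg {x : A _⦋k⦌} (hx : IsBoundary x) : IsBoundary (-x) := by
  obtain ⟨z, h1, h2, h3⟩ := hx
  exact ⟨-z, by rw [map_neg, h1], by rw [map_neg, h2, neg_zero],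
    fun i hi => by rw [map_neg, h3 i hi, neg_zero]⟩

theorem IsBoundary.smul (c : A _⦋0⦌) {x : A _⦋k⦌} (hx : IsBoundary x) :
    IsBoundary (cst c k * x) := by
  obtain ⟨z, h1, h2, h3⟩ := hx
  exact ⟨cst c (k + 1) * z, by rw [map_mul, h1, δ_cst], by rw [map_mul, h2, mul_zero],
    fun i hi => by rw [map_mul, h3 i hi, mul_zero]⟩

theorem IsBoundary.map (f : A ⟶ B) {x : A _⦋k⦌} (hx : IsBoundary x) :
    IsBoundary (f.app (op ⦋k⦌) x) := by
  obtain ⟨z, h1, h2, h3⟩ := hx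
  exact ⟨f.app (op ⦋k + 1⦌) z, by rw [← δ_hom, h1], by rw [← δ_hom, h2, map_zero],
    fun i hi => by rw [← δ_hom, h3 i hi, map_zero]⟩

/-- The witness is the last degeneracy of `y`, the constant homotopy. In degree `0` there are no
faces below the last two, so nothing remains to check. -/
theorem exists_degenerate (y : Sphere (0 : A _⦋0⦌) k) :
    ∃ z : A _⦋k + 1⦌, A.δ (Fin.last k).castSucc z = y.1 ∧ A.δ (Fin.last (k + 1)) z = y.1 ∧
      ∀ i : Fin (k + 2), i < (Fin.last k).castSucc → A.δ i z = 0 := by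
  cases k with
  | zero => exact ⟨A.σ 0 y.1, δ_σ_castSucc 0 y.1, δ_σ_succ 0 y.1, fun i hi => absurd hi (by simp)⟩
  | succ n => exact relZ_refl y.1 (faces y)

/-- Subtracting the constant homotopy on `y` from a homotopy makes its last face zero; adding it
back reverses this. The homotopy relation thereby becomes a condition on the difference, to which
linear gluing applies. -/
theorem sphere_rel_iff (x y : Sphere (0 : A _⦋0⦌) k) :
    Sphere.Rel x y ↔ IsBoundary (x.1 - y.1) := by
  obtain ⟨w, h1, h2, h3⟩ := exists_degenerate y
  simp only [Sphere.Rel, cst_zero]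
  constructor
  · rintro ⟨z, e1, e2, e3⟩
    exact ⟨z - w, by rw [map_sub, e1, h1], by rw [map_sub, e2, h2, sub_self],
      fun i hi => by rw [map_sub, e3 i hi, h3 i hi, sub_zero]⟩
  · rintro ⟨z, e1, e2, e3⟩
    exact ⟨z + w, by rw [map_add, e1, h1, sub_add_cancel], by rw [map_add, e2, h2, zero_add],
      fun i hi => by rw [map_add, e3 i hi, h3 i hi, add_zero]⟩

/-- The homotopy class of a sphere based at `0`. -/
def Htpy.mk (x : Sphere (0 : A _⦋0⦌) k) : Htpy (0 : A _⦋0⦌) k := Quot.mk _ x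

theorem Htpy.mk_surjective : Function.Surjective (Htpy.mk (A := A) (k := k)) := by
  rintro ⟨x⟩; exact ⟨x, rfl⟩

/-- Boundaries contain `0` and are closed under sums and negation, so the homotopy relation is
already an equivalence and the quotient identifies nothing further. -/
theorem Htpy.mk_eq_iff (x y : Sphere (0 : A _⦋0⦌) k) :
    Htpy.mk x = Htpy.mk y ↔ IsBoundary (x.1 - y.1) := by
  refine ⟨fun h => ?_, fun h => Quot.sound ((sphere_rel_iff x y).2 h)⟩
  have hE : Equivalence (Sphere.Rel (v := (0 : A _⦋0⦌)) (n := k)) :=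
    ⟨fun x => (sphere_rel_iff _ _).2 (by rw [sub_self]; exact IsBoundary.zero),
      fun {x y} h => (sphere_rel_iff _ _).2 (by
        rw [← neg_sub]; exact ((sphere_rel_iff _ _).1 h).neg),
      fun {x y z} h h' => (sphere_rel_iff _ _).2 (by
        rw [← sub_add_sub_cancel x.1 y.1 z.1]
        exact ((sphere_rel_iff _ _).1 h).add ((sphere_rel_iff _ _).1 h'))⟩
  exact (sphere_rel_iff x y).1 (hE.eqvGen_iff.1 (Quot.eqvGen_exact h))

theorem IsSphere.zero : IsSphere (0 : A _⦋0⦌) k 0 := by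
  cases k with
  | zero => trivial
  | succ n => exact (isSphere_zero_iff _).2 fun i => map_zero _

theorem IsSphere.add {x y : A _⦋k⦌} (hx : IsSphere 0 k x) (hy : IsSphere 0 k y) :
    IsSphere 0 k (x + y) := by
  cases k with
  | zero => trivial
  | succ n =>
    rw [isSphere_zero_iff] at *
    exact fun i => by rw [map_add, hx, hy, add_zero]

theorem IsSphere.smul (c : A _⦋0⦌) {x : A _⦋k⦌} (hx : IsSphere 0 k x) :
    IsSphere 0 k (cst c k * x) := by
  cases k with
  | zero => trivial
  | succ n =>
    rw [isSphere_zero_iff] at *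
    exact fun i => by rw [map_mul, hx, mul_zero]

end SCInfRing

/-! ### Simplices that are locally boundaries -/

section LocalBoundary

open TopCat SCInfRing

variable {X : TopCat.{u}} {P : Presheaf SCInfRing.{u} X} {k : ℕ} {U : Opens X}

/-- Restriction of spheres. -/
def resSphere {V : Opens X} (h : V ≤ U) :
    Sphere (0 : Sect P 0 U) k → Sphere (0 : Sect P 0 V) k :=
  Sphere.map (P.map (homOfLE h).op) (app_zero _) k

theorem isSphere_of_locally (hP : ∀ n : ℕ, Presheaf.IsSheaf (under (level P n))) {t : Sect P k U}
    (h : ∀ x ∈ U, ∃ (V : Opens X) (_ : x ∈ V) (hV : V ≤ U),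
      IsSphere (0 : Sect P 0 V) k (res hV t)) : IsSphere (0 : Sect P 0 U) k t := by
  cases k with
  | zero => trivial
  | succ n =>
    refine (isSphere_zero_iff _).2 fun i => eq_of_locally hP fun x hx => ?_
    obtain ⟨V, hxV, hV, ht⟩ := h x hx
    refine ⟨V, hxV, hV, ?_⟩
    rw [← δ_res, (isSphere_zero_iff _).1 ht, res_zero]

/-- `t` is locally a boundary. -/
def IsLocalBoundary (t : Sect P k U) : Prop :=
  ∀ x ∈ U, ∃ (V : Opens X) (_ : x ∈ V) (hV : V ≤ U), IsBoundary (res hV t)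

theorem isBoundary_res {V : Opens X} (h : V ≤ U) {t : Sect P k U} (ht : IsBoundary t) :
    IsBoundary (res h t) :=
  ht.map _

namespace IsLocalBoundary

theorem zero : IsLocalBoundary (0 : Sect P k U) := fun x hx =>
  ⟨U, hx, le_rfl, by rw [res_zero]; exact IsBoundary.zero⟩

theorem add {s t : Sect P k U} (hs : IsLocalBoundary s) (ht : IsLocalBoundary t) :
    IsLocalBoundary (s + t) := fun x hx => by
  obtain ⟨V, hxV, hV, h⟩ := hs x hx
  obtain ⟨W, hxW, hW, h'⟩ := ht x hx
  refine ⟨V ⊓ W, ⟨hxV, hxW⟩, inf_le_left.trans hV, ?_⟩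
  have := (isBoundary_res (inf_le_left : V ⊓ W ≤ V) h).add (isBoundary_res inf_le_right h')
  rwa [res_res, res_res, ← res_add] at this

theorem smul (c : Sect P 0 U) {t : Sect P k U} (ht : IsLocalBoundary t) :
    IsLocalBoundary (cst c k * t) := fun x hx => by
  obtain ⟨V, hxV, hV, h⟩ := ht x hx
  refine ⟨V, hxV, hV, ?_⟩
  rw [res_mul, cst_res]
  exact h.smul _

theorem restrict {V : Opens X} (hV : V ≤ U) {t : Sect P k U} (ht : IsLocalBoundary t) :
    IsLocalBoundary (res hV t) := fun x hx => by
  obtain ⟨W, hxW, hW, h⟩ := ht x (hV hx)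
  refine ⟨V ⊓ W, ⟨hx, hxW⟩, inf_le_left, ?_⟩
  have := isBoundary_res (inf_le_right : V ⊓ W ≤ W) h
  rwa [res_res] at this ⊢

theorem of_locally {t : Sect P k U} (h : ∀ x ∈ U, ∃ (V : Opens X) (_ : x ∈ V) (hV : V ≤ U),
    IsLocalBoundary (res hV t)) : IsLocalBoundary t := fun x hx => by
  obtain ⟨V, hxV, hV, hB⟩ := h x hx
  obtain ⟨W, hxW, hW, hB'⟩ := hB x hxV
  exact ⟨W, hxW, hW.trans hV, by rwa [res_res] at hB'⟩

/-- Local boundaries are boundaries of global simplices. -/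
theorem isBoundary [SecondCountableTopology X]
    (hP : ∀ n : ℕ, Presheaf.IsSheaf (under (level P n))) (hb : HasBumps P) {t : Sect P k ⊤}
    (ht : IsLocalBoundary t) : IsBoundary t := by
  -- The unknown `z` is a filler, and its boundary is scaled by the weight: the distinguished face
  -- is `p` times `t`, the other faces are zero. For `p = 1` the condition says that `z` exhibits
  -- `t` as a boundary.
  let C : LinearCondition P (k + 1) :=
    { holds := fun U p z => (P.obj (op U)).δ (Fin.last k).castSucc z = cst p k * res le_top t ∧
        ∀ i : Fin (k + 2), i ≠ (Fin.last k).castSucc → (P.obj (op U)).δ i z = 0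
      zero := fun U => ⟨by rw [map_zero, cst_zero, zero_mul], fun i _ => map_zero _⟩
      add := fun {U p q s z} h h' => ⟨by
          rw [map_add, h.1, h'.1, ← add_mul]
          unfold cst
          rw [map_add],
        fun i hi => by rw [map_add, h.2 i hi, h'.2 i hi, add_zero]⟩
      smul := fun {U} c {p z} h => ⟨by rw [map_mul, h.1, δ_cst, cst_mul', mul_assoc],
        fun i hi => by rw [map_mul, h.2 i hi, mul_zero]⟩
      restrict := fun {U V} hV {p z} h => ⟨by rw [δ_res, h.1, res_mul, cst_res, res_res],
        fun i hi => by rw [δ_res, h.2 i hi, res_zero]⟩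
      isLocal := fun {U p z} h => ⟨eq_of_locally hP fun x hx => by
          obtain ⟨V, hxV, hV, h1, -⟩ := h x hx
          exact ⟨V, hxV, hV, by rw [← δ_res, h1, res_mul, cst_res, res_res]⟩,
        fun i hi => eq_of_locally hP fun x hx => by
          obtain ⟨V, hxV, hV, -, h2⟩ := h x hx
          exact ⟨V, hxV, hV, by rw [← δ_res, h2 i hi, res_zero]⟩⟩ }
  obtain ⟨z, h1, h2⟩ := C.exists_global hP hb fun x => by
    obtain ⟨V, hxV, hV, z, h1, h2, h3⟩ := ht x trivial
    refine ⟨V, hxV, z, by rw [h1, cst_one', one_mul], fun i hi => ?_⟩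
    rcases lt_or_gt_of_ne hi with h | h
    · exact h3 i h
    · obtain rfl : i = Fin.last (k + 1) := by
        rw [Fin.lt_def] at h
        exact Fin.ext (by simp at h ⊢; omega)
      exact h2
  refine ⟨z, by rw [h1, cst_one', one_mul, res_refl], h2 _ ?_, fun i hi => h2 i hi.ne⟩
  simp [Fin.ext_iff]

end IsLocalBoundary

end LocalBoundary

/-! ### Global sections of the sheaves of homotopy groups -/

section GlobalSections

open TopCat SCInfRing

variable {X : TopCat.{u}} {P : Presheaf SCInfRing.{u} X} {k : ℕ} {U : Opens X}

theorem germ_htpyMk_resSphere {V : Opens X} (h : V ≤ U) {y : X} (hy : y ∈ V)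
    (x : Sphere (0 : Sect P 0 U) k) :
    (piPre P k).germ V y hy (Htpy.mk (resSphere h x)) = (piPre P k).germ U y (h hy) (Htpy.mk x) :=
  (piPre P k).germ_res_apply (homOfLE h) y hy (Htpy.mk x)

/-- Two germs agree exactly when the homotopy classes agree after shrinking, and by `Htpy.mk_eq_iff`
equality of classes means that the difference is a boundary. -/
theorem isLocalBoundary_iff_germ (x y : Sphere (0 : Sect P 0 U) k) :
    IsLocalBoundary (P := P) (x.1 - y.1) ↔ ∀ (z : X) (hz : z ∈ U),
      (piPre P k).germ U z hz (Htpy.mk x) = (piPre P k).germ U z hz (Htpy.mk y) := by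
  constructor
  · intro h z hz
    obtain ⟨V, hzV, hV, hB⟩ := h z hz
    rw [res_sub] at hB
    rw [← germ_htpyMk_resSphere hV hzV, ← germ_htpyMk_resSphere hV hzV,
      (Htpy.mk_eq_iff (resSphere hV x) (resSphere hV y)).2 hB]
  · intro h z hz
    obtain ⟨V, hzV, i, j, e⟩ := (piPre P k).germ_eq z hz hz _ _ (h z hz)
    refine ⟨V, hzV, i.le, ?_⟩
    rw [res_sub]
    exact (Htpy.mk_eq_iff (resSphere i.le x) (resSphere i.le y)).1 e

/-- Equal sections of the associated sheaf have equal germs, so the difference of representing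
spheres is locally a boundary, hence globally one. -/
theorem injective_toSheafify [SecondCountableTopology X]
    (hP : ∀ n : ℕ, Presheaf.IsSheaf (under (level P n))) (hb : HasBumps P) :
    Function.Injective ((piPre P k).toSheafify.app (op ⊤)) := by
  intro a b hab
  obtain ⟨x, rfl⟩ := Htpy.mk_surjective (A := P.obj (op ⊤)) a
  obtain ⟨y, rfl⟩ := Htpy.mk_surjective (A := P.obj (op ⊤)) b
  refine (Htpy.mk_eq_iff x y).2 (IsLocalBoundary.isBoundary hP hb
    ((isLocalBoundary_iff_germ x y).2 fun z hz => ?_))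
  exact congrFun (congrArg Subtype.val hab) ⟨z, hz⟩

/-- The linear problem of finding a sphere which is locally homotopic to given ones. -/
def homotopyCondition (hP : ∀ n : ℕ, Presheaf.IsSheaf (under (level P n))) {ι : Type*}
    (V : ι → Opens X) (z : ∀ i, Sect P k (V i)) : LinearCondition P k where
  -- Scaling the targets `z i` by `p` makes the condition additive in the pair `(p, t)`; for `p = 1`
  -- it asks that `t` be locally homotopic to `z i` on `U ⊓ V i`.
  holds U p t := IsSphere (0 : Sect P 0 U) k t ∧ ∀ i, IsLocalBoundary (P := P)
    (res (inf_le_left : U ⊓ V i ≤ U) t -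
      cst (res (inf_le_left : U ⊓ V i ≤ U) p) k * res inf_le_right (z i))
  zero U := ⟨IsSphere.zero, fun i => by
    rw [res_zero, res_zero, cst_zero, zero_mul, sub_zero]; exact IsLocalBoundary.zero⟩
  add {U p q s t} h h' := ⟨h.1.add h'.1, fun i => by
    convert (h.2 i).add (h'.2 i) using 1
    rw [res_add, res_add]
    have : ∀ a b : Sect P 0 (U ⊓ V i), cst (a + b) k = cst a k + cst b k := fun a b => by
      unfold cst; rw [map_add]
    rw [this]
    ring⟩
  smul {U} c {p t} h := ⟨h.1.smul c, fun i => by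
    convert (h.2 i).smul (res (inf_le_left : U ⊓ V i ≤ U) c) using 1
    rw [res_mul, res_mul, cst_res, cst_mul']
    ring⟩
  restrict {U W} hW {p t} h := ⟨(resSphere hW ⟨t, h.1⟩).2, fun i => by
    have := (h.2 i).restrict (inf_le_inf_right (V i) hW)
    rw [res_sub, res_mul, cst_res, res_res, res_res, res_res] at this
    rwa [res_res, res_res]⟩
  isLocal {U p t} h := ⟨isSphere_of_locally hP fun x hx => by
      obtain ⟨W, hxW, hW, h1, -⟩ := h x hx
      exact ⟨W, hxW, hW, h1⟩, fun i => IsLocalBoundary.of_locally fun x hx => by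
      obtain ⟨W, hxW, hW, -, h2⟩ := h x hx.1
      refine ⟨W ⊓ V i, ⟨hxW, hx.2⟩, inf_le_inf_right _ hW, ?_⟩
      have := h2 i
      rw [res_res, res_res] at this
      rwa [res_sub, res_mul, cst_res, res_res, res_res, res_res]⟩

/-- A section is locally represented by spheres. They need not agree on overlaps, but their
differences there are local boundaries, and that is enough to average them into one global sphere.
-/
theorem surjective_toSheafify [SecondCountableTopology X]
    (hP : ∀ n : ℕ, Presheaf.IsSheaf (under (level P n))) (hb : HasBumps P) :
    Function.Surjective ((piPre P k).toSheafify.app (op ⊤)) := by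
  intro s
  choose V hxV j g hg using fun x : X => Sec.exists_germ s x trivial
  choose z hz using fun x : X => Htpy.mk_surjective (A := P.obj (op (V x))) (g x)
  have hgz : ∀ (x y : X) (hy : y ∈ V x),
      (piPre P k).germ (V x) y hy (Htpy.mk (z x)) = s.1 ⟨y, trivial⟩ := fun x y hy => by
    rw [hz]
    exact (hg x y hy).symm
  -- Near `x` the representative `z x` is itself a solution: on `V x ⊓ V y` it has the same germs in
  -- `π_k` as `z y`, namely those of `s`.
  obtain ⟨t, ht, htz⟩ := (homotopyCondition hP V fun x => (z x).1).exists_global hP hb fun x => by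
    refine ⟨V x, hxV x, (z x).1, (z x).2, fun y => ?_⟩
    rw [res_one, cst_one', one_mul]
    refine (isLocalBoundary_iff_germ (resSphere inf_le_left (z x))
      (resSphere inf_le_right (z y))).2 fun w hw => ?_
    rw [germ_htpyMk_resSphere, germ_htpyMk_resSphere, hgz, hgz]
  refine ⟨Htpy.mk ⟨t, ht⟩, Subtype.ext (funext fun ⟨y, _⟩ => ?_)⟩
  have h := htz y
  rw [res_one, cst_one', one_mul] at h
  have h' := (isLocalBoundary_iff_germ (resSphere inf_le_left ⟨t, ht⟩)
    (resSphere inf_le_right (z y))).1 h y ⟨Opens.mem_top y, hxV y⟩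
  exact (germ_htpyMk_resSphere inf_le_left _ ⟨t, ht⟩).symm.trans
    (h'.trans ((germ_htpyMk_resSphere inf_le_right _ (z y)).trans (hgz y y (hxV y))))

/-- On localized simplicial `C^∞`-spaces, homotopy groups commute with global sections. -/
theorem bijective_toSheafify_of_localized (X : LocalizedSCInfSpace.{u}) (k : ℕ) :
    Function.Bijective ((piPre X.obj.presheaf k).toSheafify.app (op ⊤)) := by
  obtain ⟨⟨hP, hQ⟩, hL⟩ := X.property
  have := hQ.secondCountableTopology
  have hb := hasBumps hP hQ hL
  exact ⟨injective_toSheafify hP hb, surjective_toSheafify hP hb⟩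

end GlobalSections

/-- Bijective morphisms of `C^∞`-rings are isomorphisms. -/
theorem isIso_of_bijective {A B : CInfRingCat.{u}} (f : A ⟶ B) (hf : Function.Bijective f) :
    IsIso f := by
  let e := Equiv.ofBijective f hf
  let g : B ⟶ A :=
    { toFun := e.symm
      map_op' := fun F b => e.injective <| by
        refine (e.apply_symm_apply _).trans ((CInfHom.map_op f F fun i => e.symm (b i)).trans ?_).symm
        exact congrArg (CInfRing.op F) (funext fun i => e.apply_symm_apply (b i)) }
  exact ⟨g, CInfRingCat.hom_ext e.symm_apply_apply, CInfRingCat.hom_ext e.apply_symm_apply⟩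

theorem IsFinGen.of_bijective {A B : CInfRingCat.{u}} (f : A ⟶ B) (hf : Function.Bijective f)
    (h : IsFinGen B) : IsFinGen A := by
  have := isIso_of_bijective f hf
  obtain ⟨n, φ, hφ⟩ := h
  refine ⟨n, CInfHom.comp (inv f) φ, fun a => ?_⟩
  obtain ⟨p, hp⟩ := hφ (f a)
  refine ⟨p, (congrArg (inv f) hp).trans ?_⟩
  exact ConcreteCategory.congr_hom (IsIso.hom_inv_id f) a

/-! ### Change of base point and weak equivalences -/

namespace SCInfRing

variable {A B : SCInfRing.{u}}

/-- This is the shape in which the face condition at `0` appears after a simplex is translated by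
`v`. -/
theorem cst_sub_self (v : A _⦋0⦌) (n : ℕ) : cst (0 : A _⦋0⦌) n = cst v n - cst v n := by
  rw [cst_zero, sub_self]

/-- Translation by a vertex, on spheres. -/
def Sphere.translate (v : A _⦋0⦌) (n : ℕ) : Sphere v n ≃ Sphere (0 : A _⦋0⦌) n where
  toFun x := ⟨x.1 - cst v n, by
    obtain ⟨x, hx⟩ := x
    cases n with
    | zero => trivial
    | succ n => exact fun i => by rw [map_sub, hx, δ_cst, cst_sub_self v]⟩
  invFun x := ⟨x.1 + cst v n, by
    obtain ⟨x, hx⟩ := x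
    cases n with
    | zero => trivial
    | succ n => exact fun i => by rw [map_add, hx, δ_cst, cst_zero, zero_add]⟩
  left_inv x := Subtype.ext (sub_add_cancel _ _)
  right_inv x := Subtype.ext (add_sub_cancel_right _ _)

/-- Translation by a vertex, on homotopy sets. -/
def Htpy.translate (v : A _⦋0⦌) (n : ℕ) : Htpy v n ≃ Htpy (0 : A _⦋0⦌) n :=
  Quot.congr (Sphere.translate v n) fun x y => by
    constructor
    · rintro ⟨z, h1, h2, h3⟩
      exact ⟨z - cst v (n + 1), by rw [map_sub, h1, δ_cst]; rfl, by rw [map_sub, h2, δ_cst]; rfl,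
        fun i hi => by rw [map_sub, h3 i hi, δ_cst, cst_sub_self v]⟩
    · rintro ⟨z, h1, h2, h3⟩
      exact ⟨z + cst v (n + 1), by rw [map_add, h1, δ_cst]; exact sub_add_cancel _ _,
        by rw [map_add, h2, δ_cst]; exact sub_add_cancel _ _,
        fun i hi => by rw [map_add, h3 i hi, δ_cst, cst_zero, zero_add]⟩

/-- A morphism is additive in each degree and preserves totally degenerate simplices, so it commutes
with translations. -/
theorem Htpy.translate_map (f : A ⟶ B) (v : A _⦋0⦌) (n : ℕ) (x : Htpy v n) :
    Htpy.translate (f.app (op ⦋0⦌) v) n (Htpy.map f rfl n x) =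
      Htpy.map f (app_zero f) n (Htpy.translate v n x) := by
  obtain ⟨x⟩ := x
  refine congrArg (Quot.mk _) (Subtype.ext ?_)
  change f.app (op ⦋n⦌) x.1 - cst _ n = f.app (op ⦋n⦌) (x.1 - cst v n)
  rw [map_sub, cst_hom]

/-- Weak equivalences can be tested at the base point `0`. -/
theorem IsWeakEquiv.of_bijective_zero (f : A ⟶ B)
    (h : ∀ n : ℕ, Function.Bijective (Htpy.map f (app_zero f) n)) : IsWeakEquiv f := fun n v => by
  have : Htpy.translate (f.app (op ⦋0⦌) v) n ∘ Htpy.map f (v := v) rfl n =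
      Htpy.map f (app_zero f) n ∘ Htpy.translate v n :=
    funext (Htpy.translate_map f v n)
  rw [← (Htpy.translate (f.app (op ⦋0⦌) v) n).bijective.of_comp_iff', this]
  exact (h n).comp (Htpy.translate v n).bijective

end SCInfRing

-- The comparison maps for `X` and `Y` form a commutative square with the maps induced by `f` on
-- homotopy of global sections and on global sections of the homotopy sheaves. Three of its sides
-- are bijective, hence so is the fourth.
open AlgebraicGeometry SCInfRing in
theorem bijective_htpyMap_of_isLocalWeakEquiv {X Y : PresheafedSpace SCInfRing.{u}} (f : X ⟶ Y)
    (hf : IsLocalWeakEquiv f) (n : ℕ)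
    (hY : Function.Bijective ((piPre Y.presheaf n).toSheafify.app (op ⊤)))
    (hX : Function.Bijective ((piPre X.presheaf n).toSheafify.app (op ⊤))) :
    Function.Bijective (Htpy.map (f.c.app (op ⊤)) (app_zero _) n) := by
  have hcomm : (piPre X.presheaf n).toSheafify.app (op ⊤) ∘
        Htpy.map (f.c.app (op ⊤)) (app_zero _) n =
      piSheafMap f n ⊤ ∘ (piPre Y.presheaf n).toSheafify.app (op ⊤) :=
    funext fun a => Subtype.ext (funext fun x => (piStalkMap_germ f n x.1 ⊤ trivial a).symm)
  refine (Function.Bijective.of_comp_iff' hX _).1 ?_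
  rw [hcomm]
  exact (hf.2 n ⊤).comp hY

end DerivedCInf

theorem mainTheorem4 :
    (∀ X : DerivedCInf.LocalizedSCInfSpace.{u},
      IsIso (DerivedCInf.pi0Unit X.obj.presheaf) ∧
      ∀ n : ℕ, Function.Bijective (DerivedCInf.piSuccUnit X.obj.presheaf n)) ∧
    (∀ X : DerivedCInf.LocalizedSCInfSpace.{u},
      DerivedCInf.IsFinGen
        (DerivedCInf.SCInfRing.pi0.obj (DerivedCInf.globalSections.obj (op X)))) ∧
    (∀ (X Y : DerivedCInf.LocalizedSCInfSpace.{u}) (f : X ⟶ Y),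
      DerivedCInf.IsLocalWeakEquiv (DerivedCInf.isLocalizedSCInfSpace.{u}.ι.map f) →
      DerivedCInf.SCInfRing.IsWeakEquiv (DerivedCInf.globalSections.map f.op)) := by
  refine ⟨fun X => ⟨DerivedCInf.isIso_of_bijective _ ?_, fun n => ?_⟩, fun X => ?_,
    fun X Y f hf => ?_⟩
  · exact DerivedCInf.bijective_toSheafify_of_localized X 0
  · exact DerivedCInf.bijective_toSheafify_of_localized X (n + 1)
  · exact DerivedCInf.IsFinGen.of_bijective (DerivedCInf.pi0Unit X.obj.presheaf)
      (DerivedCInf.bijective_toSheafify_of_localized X 0) (X.property.1.isCInfSpace.finGen ⊤)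
  · exact DerivedCInf.SCInfRing.IsWeakEquiv.of_bijective_zero _ fun n =>
      DerivedCInf.bijective_htpyMap_of_isLocalWeakEquiv _ hf n
        (DerivedCInf.bijective_toSheafify_of_localized Y n)
        (DerivedCInf.bijective_toSheafify_of_localized X n)
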